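/- Let $a>b>0$ be fixed constants with $\sqrt a-\sqrt b>\sqrt2$. For an even integer $n$, let $[n]$ be partitioned into two clusters of equal size $n/2$, and let $A$ be the adjacency matrix of the random graph on $[n]$ in which every pair of distinct nodes is joined, independently of all other pairs, with probability $p=\frac{a\log n}{n}$ if the two nodes are in the same cluster and $q=\frac{b\log n}{n}$ if they are in different clusters. Let $X^\star\in\{0,1\}^{n\times n}$ be the true partition matrix: $X^\star_{ij}=1$ if $i$ and $j$ are in the same cluster, and $X^\star_{ij}=0$ otherwise. Then there are $c>0$ and $N\in\mathbb N$, depending only on $a$ and $b$, such that for every even $n\ge N$ and every such partition, with probability at least $1-n^{-c}$ the matrix $X^\star$ is the unique optimal solution of the semidefinite program $$\max_{X\in\mathbb R^{n\times n}}\ \langle X,A\rangle=\operatorname{trace}(X^\top A)\quad\text{subject to}\quad X\succeq0,\quad X_{ij}\ge0\ (1\le i,j\le n),\quad X\mathbf 1_n=\tfrac n2\mathbf 1_n,\quad X_{ii}=1\ (1\le i\le n),$$ where $X\succeq 0$ means that $X$ is symmetric positive semidefinite. -/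

import Mathlib

open MeasureTheory ProbabilityTheory Matrix

namespace SBM

/-- `A` is the random adjacency matrix of a stochastic block model on the nodes `Fin n`, with cluster
assignment `φ` and connectivity probability matrix `B`: distinct nodes `i`, `j` are joined with
probability `B (φ i) (φ j)`, independently over all unordered pairs (indexed by `i < j`). -/
structure IsAdjacency {Ω : Type*} [MeasurableSpace Ω] (μ : Measure Ω) {n r : ℕ}
    (φ : Fin n → Fin r) (B : Matrix (Fin r) (Fin r) ℝ)
    (A : Ω → Matrix (Fin n) (Fin n) ℝ) : Prop where
  measurable_entry : ∀ i j, Measurable fun ω => A ω i j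
  isSymm : ∀ ω, (A ω).IsSymm
  diag_eq_zero : ∀ ω i, A ω i i = 0
  zero_or_one : ∀ ω i j, A ω i j = 0 ∨ A ω i j = 1
  prob_edge : ∀ i j, i < j → μ.real {ω | A ω i j = 1} = B (φ i) (φ j)
  indep : iIndepFun
    (fun (e : {e : Fin n × Fin n // e.1 < e.2}) (ω : Ω) => A ω e.1.1 e.1.2) μ

/-- The connectivity probability matrix of the `(p, q)`-model: `p` on the diagonal, `q` off it. -/
def pqMatrix (r : ℕ) (p q : ℝ) : Matrix (Fin r) (Fin r) ℝ :=
  Matrix.of fun k l => if k = l then p else q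

/-- The clusters `φ ⁻¹ {k}`, for `k : Fin r`, all have size `n / r`. -/
def EqualSized {n r : ℕ} (φ : Fin n → Fin r) : Prop :=
  ∀ k, r * (Finset.univ.filter fun i => φ i = k).card = n

/-- The partition matrix of `φ`: the `(i, j)` entry is `1` if `i` and `j` lie in the same cluster,
and `0` otherwise. -/
def partitionMatrix {n r : ℕ} (φ : Fin n → Fin r) : Matrix (Fin n) (Fin n) ℝ :=
  Matrix.of fun i j => if φ i = φ j then 1 else 0

/-- The trace inner product `⟨X, A⟩ = trace (Xᵀ A)`. -/
def traceInner {n : ℕ} (X A : Matrix (Fin n) (Fin n) ℝ) : ℝ :=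
  (Xᵀ * A).trace

/-- The feasible set of the row-sum-constrained semidefinite program with `r` clusters. -/
structure IsFeasible {n : ℕ} (r : ℕ) (X : Matrix (Fin n) (Fin n) ℝ) : Prop where
  posSemidef : X.PosSemidef
  nonneg : ∀ i j, 0 ≤ X i j
  row_sum : X *ᵥ (fun _ => (1 : ℝ)) = fun _ => (n : ℝ) / (r : ℝ)
  diag_eq_one : ∀ i, X i i = 1

/-- `X` is an optimal solution of the program: maximize `⟨X, A⟩` over the feasible set. -/
def IsOptimal {n : ℕ} (r : ℕ) (A X : Matrix (Fin n) (Fin n) ℝ) : Prop :=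
  IsFeasible r X ∧ ∀ Y, IsFeasible r Y → traceInner Y A ≤ traceInner X A

/-- `X` is the unique optimal solution of the program. -/
def IsUniqueOptimal {n : ℕ} (r : ℕ) (A X : Matrix (Fin n) (Fin n) ℝ) : Prop :=
  IsOptimal r A X ∧ ∀ Y, IsOptimal r A Y → Y = X

end SBM

/-! The proof is by duality. With s the ±1 label vector, put S = D - A, where D is the diagonal
matrix of degree gaps; then S s = 0. For feasible Y, the matrix Y - J/2 (J all ones) is positive
semidefinite and kills constants, and ⟨Y, A⟩ + ⟨Y - J/2, S⟩ does not depend on Y. The planted matrix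
has zero gap because it equals J/2 + s sᵀ/2. So if S is positive definite on the complement of the
constants and s, the planted matrix is the unique optimum (`SlackPos.isUniqueOptimal`).

On that complement the mean of A acts as -p, so it suffices that every degree gap exceeds ε log n
while the spectral radius of A - E A is at most ε log n (`slackPos_of_trace_pow_lt`). A Chernoff
bound with tilt log(√a/√b) and a union bound over nodes give the first; √a - √b > √2 is exactly what
makes the exponent beat the factor n.

The second comes from the 2k-th trace moment, with k about log n. Only closed walks repeating every
edge survive in expectation. Grouped by shape, they are dominated by n times the number of such
walks on only O(k) vertices (`sum_doubleWalk_le`). That number is at most the average trace of a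
power of a small random matrix with independent mean-zero entries, which a net argument bounds
(`card_doubleWalk_le`). The moment is then at most n (C k)^k, far below (ε log n)^(2k). -/

namespace SBM

/-! ### Closed walks, their shapes, and the walk expansion of traces -/

section Walks

variable {V W : Type*} {L : ℕ}

/-- The undirected edge traversed in the `i`-th step of the walk `w`. -/
def stepEdge (w : Fin (L + 1) → V) (i : Fin L) : Sym2 V :=
  s(w i.castSucc, w i.succ)

/-- A closed walk which traverses each of its edges at least twice. -/
def IsDoubleWalk (w : Fin (L + 1) → V) : Prop :=
  w 0 = w (Fin.last L) ∧ ∀ i : Fin L, ∃ j, j ≠ i ∧ stepEdge w j = stepEdge w i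

/-- Two walks have the same shape if they have the same coincidences of vertices. -/
def SameShape (w : Fin (L + 1) → V) (u : Fin (L + 1) → W) : Prop :=
  ∀ i j, w i = w j ↔ u i = u j

lemma SameShape.symm {w : Fin (L + 1) → V} {u : Fin (L + 1) → W} (h : SameShape w u) :
    SameShape u w := fun i j => (h i j).symm

lemma SameShape.isDoubleWalk {w : Fin (L + 1) → V} {u : Fin (L + 1) → W} (h : SameShape w u)
    (hw : IsDoubleWalk w) : IsDoubleWalk u := by
  refine ⟨(h _ _).1 hw.1, fun i => ?_⟩
  obtain ⟨j, hj, he⟩ := hw.2 i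
  refine ⟨j, hj, ?_⟩
  simp only [stepEdge, Sym2.eq_iff] at he ⊢
  simpa only [h _ _] using he

lemma SameShape.card_image [DecidableEq V] [DecidableEq W] {w : Fin (L + 1) → V}
    {u : Fin (L + 1) → W} (h : SameShape w u) :
    (Finset.univ.image w).card = (Finset.univ.image u).card := by
  refine Finset.card_bij' (fun v _ => u (Function.invFun w v)) (fun v _ => w (Function.invFun u v))
    ?_ ?_ ?_ ?_
  · simp
  · simp
  · simp only [Finset.mem_image, Finset.mem_univ, true_and, forall_exists_index,
      forall_apply_eq_imp_iff]
    intro i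
    have h1 : u (Function.invFun u (u (Function.invFun w (w i)))) = u (Function.invFun w (w i)) :=
      Function.invFun_eq ⟨_, rfl⟩
    rw [(h _ _).2 h1]
    exact Function.invFun_eq ⟨_, rfl⟩
  · simp only [Finset.mem_image, Finset.mem_univ, true_and, forall_exists_index,
      forall_apply_eq_imp_iff]
    intro i
    have h1 : w (Function.invFun w (w (Function.invFun u (u i)))) = w (Function.invFun u (u i)) :=
      Function.invFun_eq ⟨_, rfl⟩
    rw [(h _ _).1 h1]
    exact Function.invFun_eq ⟨_, rfl⟩

open Classical in
/-- The number of walks of a given shape with `m` distinct vertices is a falling factorial. -/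
lemma card_sameShape [Fintype W] (w : Fin (L + 1) → V) :
    (Finset.univ.filter fun u : Fin (L + 1) → W => SameShape w u).card =
      (Fintype.card W).descFactorial (Finset.univ.image w).card := by
  have hc : Fintype.card (Set.range w) = (Finset.univ.image w).card := by
    rw [← Set.toFinset_card]; congr 1; ext; simp
  rw [← hc, ← Fintype.card_embedding_eq, ← Fintype.card_subtype]
  have hmem : ∀ f : Set.range w ↪ W, SameShape w fun i => f ⟨w i, i, rfl⟩ := by
    exact fun f i j => ⟨fun h => by simp [h], fun h => congrArg Subtype.val (f.injective h)⟩
  refine (Fintype.card_congr (Equiv.ofBijective (fun f => ⟨_, hmem f⟩) ⟨?_, ?_⟩)).symm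
  · intro f g h
    ext ⟨v, i, rfl⟩
    simpa using congrFun (congrArg Subtype.val h) i
  · rintro ⟨u, hu⟩
    refine ⟨⟨fun v => u v.2.choose, fun v v' hvv => ?_⟩, ?_⟩
    · have := (hu _ _).2 hvv
      rw [v.2.choose_spec, v'.2.choose_spec] at this
      exact Subtype.ext this
    · ext i
      refine (hu _ _).1 ?_
      exact (⟨i, rfl⟩ : w i ∈ Set.range w).choose_spec

/-- A walk has at most one more vertex than it has edges. -/
lemma card_image_le_card_stepEdge_add_one [DecidableEq V] (w : Fin (L + 1) → V) :
    (Finset.univ.image w).card ≤ (Finset.univ.image (stepEdge w)).card + 1 := by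
  classical
  rcases L.eq_zero_or_pos with rfl | hL
  · exact (Finset.card_image_le.trans (by simp)).trans (Nat.le_add_left _ _)
  have : Nonempty (Fin L) := ⟨⟨0, hL⟩⟩
  -- Each vertex other than the start is charged to the step of its first visit.
  have hsub : ∀ v ∈ (Finset.univ.image w).erase (w 0), ∃ i : Fin L, w i.succ = v ∧
      ∀ j : Fin (L + 1), j < i.succ → w j ≠ v := by
    intro v hv
    simp only [Finset.mem_erase, Finset.mem_image, Finset.mem_univ, true_and] at hv
    obtain ⟨hv0, i, hi⟩ := hv
    have hne : (Finset.univ.filter fun i => w i = v).Nonempty := ⟨i, by simp [hi]⟩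
    set k := (Finset.univ.filter fun i => w i = v).min' hne with hk
    have hkv : w k = v := by
      have := Finset.min'_mem _ hne
      simpa using this
    have hk0 : k ≠ 0 := by rintro h; rw [h] at hkv; exact hv0 hkv.symm
    obtain ⟨i', hi'⟩ := Fin.exists_succ_eq.2 hk0
    refine ⟨i', by rw [hi', hkv], fun j hj hjv => ?_⟩
    rw [hi'] at hj
    exact absurd (Finset.min'_le _ j (by simp [hjv])) (not_le.2 hj)
  choose! f hf hmin using hsub
  -- If a later first-visit step repeated an earlier edge, the vertex it discovers would be an
  -- endpoint of that edge, hence already visited.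
  have hinj : Set.InjOn (fun v => stepEdge w (f v)) ((Finset.univ.image w).erase (w 0)) := by
    have key : ∀ v ∈ (Finset.univ.image w).erase (w 0), ∀ u ∈ (Finset.univ.image w).erase (w 0),
        f v < f u → stepEdge w (f v) ≠ stepEdge w (f u) := by
      intro v hv u hu hlt he
      simp only [stepEdge, Sym2.eq_iff] at he
      rcases he with ⟨_, h2⟩ | ⟨h1, _⟩
      · rw [hf u hu] at h2
        exact hmin u hu _ (Fin.succ_lt_succ_iff.2 hlt) h2
      · rw [hf u hu] at h1
        exact hmin u hu _ (lt_trans (Fin.castSucc_lt_succ) (Fin.succ_lt_succ_iff.2 hlt)) h1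
    intro v hv u hu he
    rcases lt_trichotomy (f v) (f u) with h | h | h
    · exact absurd he (key v hv u hu h)
    · rw [← hf v hv, ← hf u hu, h]
    · exact absurd he.symm (key u hu v hv h)
  have hle : ((Finset.univ.image w).erase (w 0)).card ≤ (Finset.univ.image (stepEdge w)).card :=
    Finset.card_le_card_of_injOn _ (fun v _ => by simp) hinj
  have := Finset.card_erase_add_one (s := Finset.univ.image w) (a := w 0) (by simp)
  omega

/-- A double walk has at most `L / 2` edges. -/
lemma IsDoubleWalk.two_mul_card_le [DecidableEq V] {w : Fin (L + 1) → V} (hw : IsDoubleWalk w) :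
    2 * (Finset.univ.image (stepEdge w)).card ≤ L := by
  classical
  have h1 : L = ∑ e ∈ Finset.univ.image (stepEdge w),
      (Finset.univ.filter fun i => stepEdge w i = e).card := by
    conv_lhs => rw [← Fintype.card_fin L, ← Finset.card_univ]
    exact Finset.card_eq_sum_card_image _ _
  conv_rhs => rw [h1]
  rw [mul_comm, ← smul_eq_mul]
  refine Finset.card_nsmul_le_sum _ _ _ fun e he => ?_
  simp only [Finset.mem_image, Finset.mem_univ, true_and] at he
  obtain ⟨i, rfl⟩ := he
  obtain ⟨j, hj, he⟩ := hw.2 i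
  exact Finset.one_lt_card.2 ⟨j, by simp [he], i, by simp, hj⟩

lemma IsDoubleWalk.card_filter_ne_one [DecidableEq V] {w : Fin (L + 1) → V} (hw : IsDoubleWalk w)
    (e : Sym2 V) : (Finset.univ.filter fun i => stepEdge w i = e).card ≠ 1 := by
  intro h
  obtain ⟨i, hi⟩ := Finset.card_eq_one.1 h
  have hie : stepEdge w i = e := by
    have : i ∈ Finset.univ.filter fun i => stepEdge w i = e := by rw [hi]; simp
    simpa using this
  obtain ⟨j, hj, he⟩ := hw.2 i
  have : j ∈ Finset.univ.filter fun i => stepEdge w i = e := by simp [he, hie]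
  rw [hi] at this
  exact hj (by simpa using this)

open Classical in
/-- Comparison of weighted double walks in a large set of vertices with double walks in a small
one. -/
lemma sum_doubleWalk_le [Fintype V] [Fintype W] {k : ℕ} {p : ℝ} (hp : 0 ≤ p)
    (h1 : k + 1 ≤ Fintype.card W) (h2 : Fintype.card V * p ≤ Fintype.card W - k) :
    ∑ w : Fin (2 * k + 1) → V with IsDoubleWalk w, p ^ ((Finset.univ.image w).card - 1) ≤
      Fintype.card V *
        ((Finset.univ.filter fun u : Fin (2 * k + 1) → W => IsDoubleWalk u).card : ℝ) := by
  set n := Fintype.card V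
  set r := Fintype.card W
  have hm1 : ∀ w : Fin (2 * k + 1) → V, 1 ≤ (Finset.univ.image w).card := fun w =>
    Finset.card_pos.2 ⟨w 0, by simp⟩
  have hmk : ∀ w : Fin (2 * k + 1) → V, IsDoubleWalk w → (Finset.univ.image w).card ≤ k + 1 := by
    intro w hw
    have := card_image_le_card_stepEdge_add_one w
    have := hw.two_mul_card_le
    omega
  have hdf : ∀ w : Fin (2 * k + 1) → V, IsDoubleWalk w →
      0 < (r.descFactorial (Finset.univ.image w).card : ℝ) := by
    intro w hw
    have : 0 < r.descFactorial (Finset.univ.image w).card :=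
      Nat.descFactorial_pos.2 ((hmk w hw).trans h1)
    exact_mod_cast this
  -- Writing (x)_m for falling factorials: (n)_m p^(m-1) ≤ n (np)^(m-1) ≤ n (r-k)^m ≤ n (r)_m. The
  -- last inequality needs m ≤ k + 1, so that every factor of (r)_m is at least r - k.
  have hratio : ∀ m : ℕ, 1 ≤ m → m ≤ k + 1 →
      (n.descFactorial m : ℝ) * p ^ (m - 1) ≤ n * r.descFactorial m := by
    intro m hm hmk
    obtain ⟨m, rfl⟩ : ∃ m', m = m' + 1 := ⟨m - 1, by omega⟩
    have ha : (n.descFactorial (m + 1) : ℝ) ≤ n ^ (m + 1) := by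
      exact_mod_cast Nat.descFactorial_le_pow _ _
    have hb : ((r - k : ℕ) : ℝ) ^ (m + 1) ≤ r.descFactorial (m + 1) := by
      have h3 : (r + 1 - (m + 1)) ^ (m + 1) ≤ r.descFactorial (m + 1) :=
        Nat.pow_sub_le_descFactorial _ _
      have h4 : (r - k) ^ (m + 1) ≤ (r + 1 - (m + 1)) ^ (m + 1) :=
        Nat.pow_le_pow_left (by omega) _
      exact_mod_cast h4.trans h3
    have hc : ((r - k : ℕ) : ℝ) = r - k := by rw [Nat.cast_sub (by omega)]
    have h5 : (1 : ℝ) ≤ ((r - k : ℕ) : ℝ) := by exact_mod_cast (by omega : 1 ≤ r - k)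
    have h6 : ((n : ℝ) * p) ^ m ≤ ((r - k : ℕ) : ℝ) ^ (m + 1) := by
      rw [pow_succ]
      calc ((n : ℝ) * p) ^ m ≤ ((r - k : ℕ) : ℝ) ^ m := by
            rw [hc]; exact pow_le_pow_left₀ (by positivity) h2 _
        _ ≤ _ := le_mul_of_one_le_right (by positivity) h5
    calc (n.descFactorial (m + 1) : ℝ) * p ^ (m + 1 - 1)
        ≤ n ^ (m + 1) * p ^ m := by
          rw [Nat.add_sub_cancel]; exact mul_le_mul_of_nonneg_right ha (by positivity)
      _ = n * ((n : ℝ) * p) ^ m := by ring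
      _ ≤ n * r.descFactorial (m + 1) :=
          mul_le_mul_of_nonneg_left (h6.trans hb) (by positivity)
  -- Double counting over pairs of equal shape: the weight of `w` is spread evenly over its (r)_m
  -- copies in `W`, and the sums are exchanged.
  calc ∑ w : Fin (2 * k + 1) → V with IsDoubleWalk w, p ^ ((Finset.univ.image w).card - 1)
      = ∑ w : Fin (2 * k + 1) → V with IsDoubleWalk w,
          ∑ u : Fin (2 * k + 1) → W with IsDoubleWalk u, if SameShape w u then
            p ^ ((Finset.univ.image u).card - 1) /
              r.descFactorial (Finset.univ.image u).card else 0 := by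
        refine Finset.sum_congr rfl fun w hw => ?_
        replace hw : IsDoubleWalk w := by simpa using hw
        rw [← Finset.sum_filter, Finset.filter_filter]
        have : (Finset.univ.filter fun u : Fin (2 * k + 1) → W => IsDoubleWalk u ∧ SameShape w u) =
            Finset.univ.filter fun u => SameShape w u := by
          ext u; simp only [Finset.mem_filter, Finset.mem_univ, true_and]
          exact ⟨fun h => h.2, fun h => ⟨h.isDoubleWalk hw, h⟩⟩
        rw [this, Finset.sum_congr rfl (g := fun _ => p ^ ((Finset.univ.image w).card - 1) /
              (r.descFactorial (Finset.univ.image w).card : ℝ)), Finset.sum_const,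
          card_sameShape, nsmul_eq_mul, mul_div_cancel₀ _ (hdf w hw).ne']
        intro u hu
        rw [(show SameShape w u by simpa using hu).card_image]
    _ = ∑ u : Fin (2 * k + 1) → W with IsDoubleWalk u,
          ∑ w : Fin (2 * k + 1) → V with IsDoubleWalk w, if SameShape w u then
            p ^ ((Finset.univ.image u).card - 1) /
              r.descFactorial (Finset.univ.image u).card else 0 := Finset.sum_comm
    _ ≤ ∑ u : Fin (2 * k + 1) → W with IsDoubleWalk u, (n : ℝ) := by
        refine Finset.sum_le_sum fun u hu => ?_
        replace hu : IsDoubleWalk u := by simpa using hu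
        rw [← Finset.sum_filter, Finset.filter_filter, Finset.sum_const, nsmul_eq_mul]
        have : (Finset.univ.filter fun w : Fin (2 * k + 1) → V => IsDoubleWalk w ∧ SameShape w u) =
            Finset.univ.filter fun w => SameShape u w := by
          ext w; simp only [Finset.mem_filter, Finset.mem_univ, true_and]
          exact ⟨fun h => h.2.symm, fun h => ⟨h.isDoubleWalk hu, h.symm⟩⟩
        rw [this, card_sameShape, mul_div_assoc']
        have hm : (Finset.univ.image u).card ≤ k + 1 := by
          have := card_image_le_card_stepEdge_add_one u
          have := hu.two_mul_card_le
          omega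
        have hpos : 0 < r.descFactorial (Finset.univ.image u).card :=
          Nat.descFactorial_pos.2 (hm.trans h1)
        rw [div_le_iff₀ (by exact_mod_cast hpos)]
        exact hratio _ (Finset.card_pos.2 ⟨u 0, by simp⟩) hm
    _ = _ := by rw [Finset.sum_const, nsmul_eq_mul, mul_comm]

/-- Entries of powers of a matrix as sums over walks. -/
lemma pow_apply_eq_sum_walk [Fintype V] [DecidableEq V] (M : Matrix V V ℝ) (L : ℕ) (a b : V) :
    (M ^ L) a b = ∑ w : Fin (L + 1) → V,
      if w 0 = a ∧ w (Fin.last L) = b then ∏ i : Fin L, M (w i.castSucc) (w i.succ) else 0 := by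
  induction L generalizing a with
  | zero =>
    rw [pow_zero, ← (Equiv.funUnique (Fin 1) V).symm.sum_comp]
    simp only [Equiv.funUnique_symm_apply, uniqueElim_const, Finset.univ_eq_empty,
      Finset.prod_empty, Matrix.one_apply]
    rw [Finset.sum_eq_single a] <;> simp +contextual
  | succ L ih =>
    rw [pow_succ', Matrix.mul_apply, ← (Fin.consEquiv fun _ => V).sum_comp, Fintype.sum_prod_type]
    symm
    rw [Finset.sum_eq_single a]
    · simp only [ih, Finset.mul_sum]
      rw [Finset.sum_comm]
      refine Finset.sum_congr rfl fun w _ => ?_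
      symm
      rw [Finset.sum_eq_single (w 0)]
      · simp [Fin.consEquiv, Fin.prod_univ_succ, ← Fin.succ_last, mul_ite]
      · intro c _ hc
        simp [hc.symm]
      · simp
    · intro c _ hc
      simp [Fin.consEquiv, hc]
    · simp

lemma trace_pow_eq_sum_walk [Fintype V] [DecidableEq V] (M : Matrix V V ℝ) (L : ℕ) :
    (M ^ L).trace = ∑ w : Fin (L + 1) → V,
      if w 0 = w (Fin.last L) then ∏ i : Fin L, M (w i.castSucc) (w i.succ) else 0 := by
  simp only [Matrix.trace, Matrix.diag_apply, pow_apply_eq_sum_walk]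
  rw [Finset.sum_comm]
  refine Finset.sum_congr rfl fun w _ => ?_
  rw [Finset.sum_eq_single (w 0)]
  · simp [eq_comm]
  · intro c _ hc
    simp [hc.symm]
  · simp

end Walks

/-! ### Eigenvalues, traces and quadratic forms of symmetric matrices -/

section Spectral

variable {V : Type*} [Fintype V] [DecidableEq V] {M : Matrix V V ℝ}

lemma trace_pow_eq_sum_eigenvalues_pow (hM : M.IsHermitian) (m : ℕ) :
    (M ^ m).trace = ∑ i, hM.eigenvalues i ^ m := by
  conv_lhs => rw [hM.spectral_theorem, ← map_pow]
  rw [Unitary.conjStarAlgAut_apply, Matrix.trace_mul_cycle]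
  simp [Matrix.diagonal_pow, Matrix.trace]

lemma exists_dotProduct_mulVec_eq_sum (hM : M.IsHermitian) (x : V → ℝ) :
    ∃ y : V → ℝ, x ⬝ᵥ M *ᵥ x = ∑ i, hM.eigenvalues i * y i ^ 2 ∧ x ⬝ᵥ x = ∑ i, y i ^ 2 := by
  set U : Matrix V V ℝ := hM.eigenvectorUnitary.1 with hU
  have hUU : U * star U = 1 := Unitary.mul_star_self_of_mem hM.eigenvectorUnitary.2
  have h := hM.spectral_theorem
  rw [Unitary.conjStarAlgAut_apply] at h
  have hs : star U = Uᵀ := by simp [star_eq_conjTranspose]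
  refine ⟨Uᵀ *ᵥ x, ?_, ?_⟩
  · conv_lhs => rw [h]
    rw [← hU, hs, ← Matrix.mulVec_mulVec, ← Matrix.mulVec_mulVec, Matrix.dotProduct_mulVec,
      ← Matrix.mulVec_transpose]
    simp only [dotProduct, Matrix.mulVec_diagonal]
    refine Finset.sum_congr rfl fun i _ => ?_
    simp; ring
  · have : x ⬝ᵥ x = x ⬝ᵥ (U * Uᵀ) *ᵥ x := by rw [← hs, hUU, Matrix.one_mulVec]
    rw [this, ← Matrix.mulVec_mulVec, Matrix.dotProduct_mulVec, ← Matrix.mulVec_transpose]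
    simp only [dotProduct, sq]

lemma abs_dotProduct_mulVec_le (hM : M.IsHermitian) {c : ℝ} (hc : ∀ i, |hM.eigenvalues i| ≤ c)
    (x : V → ℝ) : |x ⬝ᵥ M *ᵥ x| ≤ c * (x ⬝ᵥ x) := by
  obtain ⟨y, h1, h2⟩ := exists_dotProduct_mulVec_eq_sum hM x
  rw [h1, h2, Finset.mul_sum]
  refine (Finset.abs_sum_le_sum_abs _ _).trans (Finset.sum_le_sum fun i _ => ?_)
  rw [abs_mul, abs_of_nonneg (sq_nonneg (y i))]
  exact mul_le_mul_of_nonneg_right (hc i) (sq_nonneg _)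

end Spectral

/-! ### Counting double walks through a small random matrix and a lattice net -/

section Comparison

/-- Three equally likely values with mean zero and positive higher moments. -/
def skewVal : Fin 3 → ℝ := ![2, -1, -1]

/-- The symmetric matrix with entries `skewVal (θ s(u, v))`. -/
def skewMatrix {V : Type*} (θ : Sym2 V → Fin 3) : Matrix V V ℝ :=
  Matrix.of fun u v => skewVal (θ s(u, v))

lemma skewMatrix_isHermitian {V : Type*} (θ : Sym2 V → Fin 3) : (skewMatrix θ).IsHermitian := by
  ext u v
  simp [skewMatrix, Sym2.eq_swap]

/-- Under the uniform law on three labels, every moment but the first is at least 1. Symmetric signs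
would not do: a double walk may use an edge three times, and their third moment vanishes. -/
lemma three_le_sum_skewVal_pow {m : ℕ} (hm : m ≠ 1) : 3 ≤ ∑ c, skewVal c ^ m := by
  simp only [skewVal, Fin.sum_univ_three, Matrix.cons_val_zero, Matrix.cons_val_one,
    Matrix.cons_val]
  rcases m with _ | _ | _ | m
  · norm_num
  · exact absurd rfl hm
  · norm_num
  · have h1 : (1 : ℝ) ≤ 2 ^ m := one_le_pow₀ (by norm_num)
    rcases neg_one_pow_eq_or ℝ (m + 1 + 1 + 1) with h | h <;> rw [h, pow_succ, pow_succ, pow_succ] <;>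
      linarith

lemma sum_skewVal_pow_nonneg (m : ℕ) : 0 ≤ ∑ c, skewVal c ^ m := by
  by_cases hm : m = 1
  · subst hm
    simp [skewVal, Fin.sum_univ_three]
    norm_num
  · exact le_trans (by norm_num) (three_le_sum_skewVal_pow hm)

/-- For a mean-zero variable the linear term averages out, leaving a sub-Gaussian bound. -/
lemma exp_le_add_exp_sq (x : ℝ) : Real.exp x ≤ x + Real.exp (x ^ 2) := by
  rcases le_or_gt |x| 1 with h | h
  · have h1 := (abs_le.1 (Real.abs_exp_sub_one_sub_id_le h)).2
    have h2 := Real.add_one_le_exp (x ^ 2)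
    linarith
  · rcases lt_abs.1 h with h | h
    · have : Real.exp x ≤ Real.exp (x ^ 2) := Real.exp_le_exp.2 (by nlinarith)
      linarith
    · have h1 : Real.exp x ≤ 1 := Real.exp_le_one_iff.2 (by linarith)
      have h2 := Real.add_one_le_exp (x ^ 2)
      nlinarith

lemma sum_exp_skewVal_le (s : ℝ) :
    ∑ c, Real.exp (s * skewVal c) ≤ 3 * Real.exp (4 * s ^ 2) := by
  simp only [skewVal, Fin.sum_univ_three, Matrix.cons_val_zero, Matrix.cons_val_one,
    Matrix.cons_val]
  have h1 := exp_le_add_exp_sq (s * 2)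
  have h2 := exp_le_add_exp_sq (s * -1)
  have h3 : Real.exp ((s * -1) ^ 2) ≤ Real.exp (4 * s ^ 2) := Real.exp_le_exp.2 (by nlinarith)
  have h4 : (s * 2) ^ 2 = 4 * s ^ 2 := by ring
  rw [h4] at h1
  linarith

lemma prod_comp_eq_prod_pow {ι κ R : Type*} [Fintype ι] [Fintype κ] [DecidableEq κ]
    [CommMonoid R] (g : ι → κ) (f : κ → R) :
    ∏ i, f (g i) = ∏ e, f e ^ (Finset.univ.filter fun i => g i = e).card := by
  rw [← Finset.prod_fiberwise (s := Finset.univ) (g := g)]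
  refine Finset.prod_congr rfl fun e _ => ?_
  rw [← Finset.prod_const]
  exact Finset.prod_congr rfl fun i hi => by rw [(Finset.mem_filter.1 hi).2]

lemma sum_prod_eq_prod_sum {κ γ : Type*} [Fintype κ] [DecidableEq κ] [Fintype γ]
    (F : κ → γ → ℝ) : ∑ θ : κ → γ, ∏ e, F e (θ e) = ∏ e, ∑ c, F e c := by
  rw [Finset.prod_univ_sum, Fintype.piFinset_univ]

variable {V : Type*} [Fintype V] [DecidableEq V]

open Classical in
-- The sum over `θ` is an unnormalised expectation over independent labels. Each closed walk
-- contributes a product of moments, which is nonnegative always and at least 1 after normalisation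
-- for a double walk.
lemma card_doubleWalk_mul_le_sum_trace (L : ℕ) :
    ((Finset.univ.filter fun w : Fin (L + 1) → V => IsDoubleWalk w).card : ℝ) *
      3 ^ Fintype.card (Sym2 V) ≤ ∑ θ : Sym2 V → Fin 3, (skewMatrix θ ^ L).trace := by
  simp only [trace_pow_eq_sum_walk]
  rw [Finset.sum_comm, ← nsmul_eq_mul, ← Finset.sum_const, Finset.sum_filter]
  refine Finset.sum_le_sum fun w _ => ?_
  by_cases h0 : w 0 = w (Fin.last L)
  · simp only [h0, if_true]
    have h1 : ∑ θ : Sym2 V → Fin 3, ∏ i : Fin L, skewMatrix θ (w i.castSucc) (w i.succ) =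
        ∏ e, ∑ c, skewVal c ^ (Finset.univ.filter fun i => stepEdge w i = e).card := by
      rw [← sum_prod_eq_prod_sum]
      refine Finset.sum_congr rfl fun θ _ => ?_
      exact prod_comp_eq_prod_pow (stepEdge w) (fun e => skewVal (θ e))
    rw [h1]
    split_ifs with hw
    · rw [← Finset.card_univ, ← Finset.prod_const]
      exact Finset.prod_le_prod (fun _ _ => by norm_num)
        fun e _ => three_le_sum_skewVal_pow (hw.card_filter_ne_one e)
    · exact Finset.prod_nonneg fun e _ => sum_skewVal_pow_nonneg _
  · rw [if_neg fun h => h0 h.1]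
    simp [h0]

/-- The quadratic form is linear in the independent labels, so the exponential factors over edges.
An unordered pair has at most two orderings, so the squared coefficients sum to at most 2 (x ⬝ᵥ x)²,
whence 8 = 4 · 2. -/
lemma sum_exp_skewMatrix_le (x : V → ℝ) (t : ℝ) :
    ∑ θ : Sym2 V → Fin 3, Real.exp (t * (x ⬝ᵥ skewMatrix θ *ᵥ x)) ≤
      3 ^ Fintype.card (Sym2 V) * Real.exp (8 * t ^ 2 * (x ⬝ᵥ x) ^ 2) := by
  set c : Sym2 V → ℝ := fun e => ∑ p : V × V with s(p.1, p.2) = e, x p.1 * x p.2 with hc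
  have hq : ∀ θ : Sym2 V → Fin 3, x ⬝ᵥ skewMatrix θ *ᵥ x = ∑ e, c e * skewVal (θ e) := by
    intro θ
    simp only [dotProduct, Matrix.mulVec, Finset.mul_sum, hc, Finset.sum_mul]
    rw [← Fintype.sum_prod_type', ← Finset.sum_fiberwise (s := Finset.univ)
      (g := fun p : V × V => s(p.1, p.2))]
    refine Finset.sum_congr rfl fun e _ => Finset.sum_congr rfl fun p hp => ?_
    rw [← (Finset.mem_filter.1 hp).2]
    simp [skewMatrix]; ring
  have hcs : ∑ e, c e ^ 2 ≤ 2 * (x ⬝ᵥ x) ^ 2 := by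
    have h1 : (x ⬝ᵥ x) ^ 2 = ∑ e, ∑ p : V × V with s(p.1, p.2) = e, (x p.1 * x p.2) ^ 2 := by
      rw [Finset.sum_fiberwise, sq, dotProduct, Finset.sum_mul_sum, ← Fintype.sum_prod_type']
      exact Finset.sum_congr rfl fun p _ => by ring
    rw [h1, Finset.mul_sum]
    refine Finset.sum_le_sum fun e _ => ?_
    have hcard : (Finset.univ.filter fun p : V × V => s(p.1, p.2) = e).card ≤ 2 := by
      induction e with
      | _ a b =>
        refine (Finset.card_le_card (t := {(a, b), (b, a)}) ?_).trans Finset.card_le_two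
        rintro ⟨p, q⟩ hp
        simpa [Sym2.eq_iff] using hp
    refine sq_sum_le_card_mul_sum_sq.trans ?_
    exact mul_le_mul_of_nonneg_right (by exact_mod_cast hcard)
      (Finset.sum_nonneg fun _ _ => sq_nonneg _)
  have hexp : ∀ θ : Sym2 V → Fin 3, Real.exp (t * (x ⬝ᵥ skewMatrix θ *ᵥ x)) =
      ∏ e, Real.exp (t * c e * skewVal (θ e)) := by
    intro θ
    rw [hq, Finset.mul_sum, Real.exp_sum]
    exact Finset.prod_congr rfl fun e _ => by rw [mul_assoc]
  simp only [hexp]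
  rw [sum_prod_eq_prod_sum fun e c' => Real.exp (t * c e * skewVal c')]
  calc ∏ e, ∑ c', Real.exp (t * c e * skewVal c')
      ≤ ∏ e, 3 * Real.exp (4 * (t * c e) ^ 2) :=
        Finset.prod_le_prod (fun e _ => Finset.sum_nonneg fun _ _ => (Real.exp_pos _).le)
          fun e _ => sum_exp_skewVal_le _
    _ = 3 ^ Fintype.card (Sym2 V) * Real.exp (4 * t ^ 2 * ∑ e, c e ^ 2) := by
        rw [Finset.prod_mul_distrib, Finset.prod_const, Finset.card_univ, ← Real.exp_sum,
          Finset.mul_sum]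
        simp only [mul_pow, mul_assoc]
    _ ≤ _ := by
        refine mul_le_mul_of_nonneg_left (Real.exp_le_exp.2 ?_) (by positivity)
        nlinarith [sq_nonneg t]

variable (V) in
/-- Integer vectors whose rescalings by `1 / (2 √|V|)` approximate the unit sphere. -/
noncomputable def latticeNet : Finset (V → ℤ) :=
  (Fintype.piFinset fun _ : V =>
    Finset.Icc (-((7 * Fintype.card V : ℕ) : ℤ)) ((7 * Fintype.card V : ℕ) : ℤ)).filter
      fun z => ∑ i, z i ^ 2 ≤ 7 * Fintype.card V

/-- The rescaling of an integer vector. -/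
noncomputable def rescale (z : V → ℤ) : V → ℝ := fun i => z i / (2 * √(Fintype.card V))

/-- The box in the definition only ensures finiteness: integers satisfy |z| ≤ z², so the bound on
the sum of squares implies it. -/
lemma mem_latticeNet {z : V → ℤ} : z ∈ latticeNet V ↔ ∑ i, z i ^ 2 ≤ 7 * Fintype.card V := by
  simp only [latticeNet, Finset.mem_filter, Fintype.mem_piFinset, Finset.mem_Icc,
    and_iff_right_iff_imp, ← abs_le]
  intro h i
  have h1 : z i ^ 2 ≤ ∑ i, z i ^ 2 :=
    Finset.single_le_sum (f := fun i => z i ^ 2) (fun _ _ => sq_nonneg _) (Finset.mem_univ i)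
  have h2 : |z i| ≤ z i ^ 2 := by simpa using Int.natAbs_le_self_sq (z i)
  push_cast
  linarith

lemma sum_half_pow_natAbs_le (B : ℕ) :
    ∑ j ∈ Finset.Icc (-(B : ℤ)) B, (1 / 2 : ℝ) ^ j.natAbs ≤ 3 := by
  suffices ∑ j ∈ Finset.Icc (-(B : ℤ)) B, (1 / 2 : ℝ) ^ j.natAbs = 3 - 2 * (1 / 2) ^ B by
    rw [this]; linarith [show (0 : ℝ) < (1 / 2) ^ B by positivity]
  induction B with
  | zero => norm_num
  | succ B ih =>
    have : Finset.Icc (-((B + 1 : ℕ) : ℤ)) (B + 1 : ℕ) =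
        insert ((B + 1 : ℕ) : ℤ) (insert (-((B + 1 : ℕ) : ℤ)) (Finset.Icc (-(B : ℤ)) B)) := by
      ext j; simp only [Finset.mem_insert, Finset.mem_Icc]; omega
    rw [this, Finset.sum_insert, Finset.sum_insert, ih, Int.natAbs_neg, Int.natAbs_natCast, pow_succ]
    · ring
    · simp
    · simp only [Finset.mem_insert, Finset.mem_Icc]; omega

variable (V) in
-- Net points have ℓ¹ norm at most 7r, so 2^(7r) ∏ 2^(-|z i|) is at least 1 on the net. Its sum over
-- the box factors, giving 384 = 2^7 · 3.
lemma card_latticeNet_le : ((latticeNet V).card : ℝ) ≤ 384 ^ Fintype.card V := by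
  set r := Fintype.card V with hr
  have h1 : ∀ z ∈ latticeNet V, (1 : ℝ) ≤ 2 ^ (7 * r) * ∏ i, (1 / 2 : ℝ) ^ (z i).natAbs := by
    intro z hz
    rw [mem_latticeNet] at hz
    rw [Finset.prod_pow_eq_pow_sum, one_div, inv_pow, ← div_eq_mul_inv, one_le_div (by positivity)]
    refine pow_le_pow_right₀ (by norm_num) ?_
    zify
    refine (Finset.sum_le_sum fun i _ => ?_).trans hz
    simpa using Int.natAbs_le_self_sq (z i)
  calc ((latticeNet V).card : ℝ) = ∑ z ∈ latticeNet V, (1 : ℝ) := by simp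
    _ ≤ ∑ z ∈ latticeNet V, 2 ^ (7 * r) * ∏ i, (1 / 2 : ℝ) ^ (z i).natAbs := Finset.sum_le_sum h1
    _ ≤ ∑ z ∈ Fintype.piFinset fun _ : V =>
          Finset.Icc (-((7 * r : ℕ) : ℤ)) ((7 * r : ℕ) : ℤ),
          2 ^ (7 * r) * ∏ i, (1 / 2 : ℝ) ^ (z i).natAbs :=
        Finset.sum_le_sum_of_subset_of_nonneg (Finset.filter_subset _ _)
          fun _ _ _ => by positivity
    _ = 2 ^ (7 * r) * ∏ _i : V, ∑ j ∈ Finset.Icc (-((7 * r : ℕ) : ℤ)) ((7 * r : ℕ) : ℤ),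
          (1 / 2 : ℝ) ^ j.natAbs := by
        rw [← Finset.mul_sum, Finset.prod_univ_sum]
    _ ≤ 2 ^ (7 * r) * ∏ _i : V, (3 : ℝ) := by
        refine mul_le_mul_of_nonneg_left (Finset.prod_le_prod (fun _ _ => ?_) fun _ _ => ?_)
          (by positivity)
        · exact Finset.sum_nonneg fun _ _ => by positivity
        · exact sum_half_pow_natAbs_le _
    _ = 384 ^ r := by
        rw [Finset.prod_const, Finset.card_univ, ← hr, pow_mul, ← mul_pow]; norm_num

lemma rescale_dotProduct_self_le {z : V → ℤ} (hz : z ∈ latticeNet V) :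
    rescale z ⬝ᵥ rescale z ≤ 7 / 4 := by
  rw [mem_latticeNet] at hz
  rcases isEmpty_or_nonempty V with h | h
  · simp only [dotProduct, Finset.univ_eq_empty, Finset.sum_empty]; norm_num
  have hr : (0 : ℝ) < Fintype.card V := by exact_mod_cast Fintype.card_pos
  have h1 : rescale z ⬝ᵥ rescale z = (∑ i, (z i : ℝ) ^ 2) / (4 * Fintype.card V) := by
    rw [dotProduct, Finset.sum_div]
    refine Finset.sum_congr rfl fun i _ => ?_
    rw [rescale, div_mul_div_comm, mul_mul_mul_comm, Real.mul_self_sqrt hr.le]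
    ring
  have h2 : ∑ i, (z i : ℝ) ^ 2 ≤ 7 * Fintype.card V := by exact_mod_cast hz
  rw [h1, div_le_iff₀ (by positivity)]
  linarith

/-- The spectral radius of a symmetric matrix is controlled by its quadratic form on the net. -/
lemma exists_mem_latticeNet_eigenvalues_le {M : Matrix V V ℝ} (hM : M.IsHermitian) [Nonempty V] :
    ∃ z ∈ latticeNet V, ∀ i, |hM.eigenvalues i| ≤ 3 * |rescale z ⬝ᵥ M *ᵥ rescale z| := by
  obtain ⟨i, -, hi⟩ := Finset.exists_max_image Finset.univ (fun i => |hM.eigenvalues i|)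
    Finset.univ_nonempty
  replace hi := fun j => hi j (Finset.mem_univ j)
  set Λ := |hM.eigenvalues i| with hΛ
  have hr : (0 : ℝ) < Fintype.card V := by exact_mod_cast Fintype.card_pos
  set s := 2 * √(Fintype.card V : ℝ) with hs
  have hs0 : 0 < s := by positivity
  have hs2 : s ^ 2 = 4 * Fintype.card V := by rw [hs, mul_pow, Real.sq_sqrt hr.le]; norm_num
  set x : V → ℝ := ⇑(hM.eigenvectorBasis i) with hx
  have hMx : M *ᵥ x = hM.eigenvalues i • x := hM.mulVec_eigenvectorBasis i
  have hxx : x ⬝ᵥ x = 1 := by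
    have h := hM.eigenvectorBasis.orthonormal.1 i
    rw [EuclideanSpace.norm_eq, Real.sqrt_eq_one] at h
    simpa [dotProduct, sq, hx] using h
  -- The net point is the rounded top eigenvector; each coordinate is off by at most 1/(2s), so the
  -- error `h` has squared norm at most 1/16.
  set z : V → ℤ := fun j => round (s * x j) with hz
  set h : V → ℝ := x - rescale z with hh
  have hhj : ∀ j, h j ^ 2 ≤ 1 / (16 * Fintype.card V) := by
    intro j
    have h1 : s * h j = s * x j - round (s * x j) := by
      simp only [hh, Pi.sub_apply, rescale, ← hs, hz]
      field_simp
    have h2 : |s * h j| ≤ 1 / 2 := by rw [h1]; exact abs_sub_round _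
    have h3 : (s * h j) ^ 2 ≤ (1 / 2) ^ 2 := sq_le_sq' (abs_le.1 h2).1 (abs_le.1 h2).2
    rw [mul_pow, hs2] at h3
    rw [le_div_iff₀ (by positivity)]
    linarith
  have hh2 : h ⬝ᵥ h ≤ 1 / 16 := by
    calc h ⬝ᵥ h = ∑ j, h j ^ 2 := by simp only [dotProduct, sq]
      _ ≤ ∑ _j : V, 1 / (16 * (Fintype.card V : ℝ)) := Finset.sum_le_sum fun j _ => hhj j
      _ = 1 / 16 := by
        rw [Finset.sum_const, Finset.card_univ, nsmul_eq_mul]; field_simp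
  have hhx : |h ⬝ᵥ x| ≤ 1 / 4 := by
    refine abs_le_of_sq_le_sq ?_ (by norm_num)
    have := Finset.sum_mul_sq_le_sq_mul_sq Finset.univ h x
    have e1 : ∑ j, x j ^ 2 = 1 := by rw [← hxx]; simp only [dotProduct, sq]
    have e2 : ∑ j, h j ^ 2 = h ⬝ᵥ h := by simp only [dotProduct, sq]
    rw [e1, e2, mul_one] at this
    exact this.trans (hh2.trans (by norm_num))
  have hhx' := abs_le.1 hhx
  have hresc : rescale z = x - h := by rw [hh]; simp
  refine ⟨z, ?_, ?_⟩
  · rw [mem_latticeNet]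
    have h1 : rescale z ⬝ᵥ rescale z ≤ 25 / 16 := by
      simp only [hresc, sub_dotProduct, dotProduct_sub, hxx, dotProduct_comm x h]
      clear_value h
      linarith
    have h2 : ∑ j, (z j : ℝ) ^ 2 = s ^ 2 * (rescale z ⬝ᵥ rescale z) := by
      rw [dotProduct, Finset.mul_sum]
      refine Finset.sum_congr rfl fun j _ => ?_
      rw [rescale, ← hs]
      field_simp
    have h3 : ∑ j, (z j : ℝ) ^ 2 ≤ 7 * Fintype.card V := by
      rw [h2, hs2]; nlinarith
    exact_mod_cast h3
  · intro j
    refine (hi j).trans ?_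
    -- Expanding at `x - h`, the main term is at least Λ/2 and the error at most Λ/16, leaving 7Λ/16
    -- ≥ Λ/3.
    have h1 : rescale z ⬝ᵥ M *ᵥ rescale z =
        hM.eigenvalues i * (1 - 2 * (h ⬝ᵥ x)) + h ⬝ᵥ M *ᵥ h := by
      have hsymm : x ⬝ᵥ M *ᵥ h = hM.eigenvalues i * (h ⬝ᵥ x) := by
        rw [Matrix.dotProduct_mulVec, ← Matrix.mulVec_transpose,
          show Mᵀ = M by simpa using hM.eq, hMx, smul_dotProduct, dotProduct_comm, smul_eq_mul]
      rw [hresc, Matrix.mulVec_sub, sub_dotProduct, dotProduct_sub, dotProduct_sub, hsymm, hMx,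
        dotProduct_smul, dotProduct_smul, hxx]
      simp only [smul_eq_mul]
      ring
    have h2 := abs_dotProduct_mulVec_le hM hi h
    have hΛ0 : 0 ≤ Λ := abs_nonneg _
    have h3 : |h ⬝ᵥ M *ᵥ h| ≤ Λ / 16 := h2.trans (by nlinarith)
    have h4 : Λ / 2 ≤ |hM.eigenvalues i * (1 - 2 * (h ⬝ᵥ x))| := by
      rw [abs_mul, ← hΛ, abs_of_nonneg (by linarith : 0 ≤ 1 - 2 * (h ⬝ᵥ x))]
      nlinarith
    have h5 : |hM.eigenvalues i * (1 - 2 * (h ⬝ᵥ x))| ≤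
        |rescale z ⬝ᵥ M *ᵥ rescale z| + |h ⬝ᵥ M *ᵥ h| := by
      have := abs_sub (rescale z ⬝ᵥ M *ᵥ rescale z) (h ⬝ᵥ M *ᵥ h)
      rwa [h1, add_sub_cancel_right, ← h1] at this
    linarith

/-- One term of the series of exp |tq|, with the absolute value removed by adding both signs. This
turns exponential moments into 2k-th moments. -/
lemma pow_two_mul_le_factorial_mul {t : ℝ} (ht : 0 < t) (k : ℕ) (q : ℝ) :
    q ^ (2 * k) ≤ (2 * k).factorial / t ^ (2 * k) * (Real.exp (t * q) + Real.exp (-t * q)) := by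
  have h1 := Real.pow_div_factorial_le_exp |t * q| (abs_nonneg _) (2 * k)
  have h2 : Real.exp |t * q| ≤ Real.exp (t * q) + Real.exp (-t * q) := by
    rcases abs_choice (t * q) with h | h <;> rw [h]
    · linarith [Real.exp_pos (-t * q)]
    · rw [neg_mul]; linarith [Real.exp_pos (t * q)]
  rw [(even_two_mul k).pow_abs, div_le_iff₀ (by positivity), mul_pow] at h1
  rw [div_mul_eq_mul_div, le_div_iff₀ (by positivity)]
  have h3 : (0 : ℝ) < (2 * k).factorial := by positivity
  nlinarith

open Classical in
-- The trace is at most |V| times the 2k-th power of the spectral radius. That power is at most 9^k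
-- times the 2k-th power of the form at some net point, hence at most the sum over all of them.
-- Taking t = √k makes the exponential moment exp(O(k)): 8k (7/4)² ≤ 25k.
lemma card_doubleWalk_le [Nonempty V] {k : ℕ} (hk : 0 < k) :
    ((Finset.univ.filter fun w : Fin (2 * k + 1) → V => IsDoubleWalk w).card : ℝ) ≤
      Fintype.card V * (384 ^ Fintype.card V * (9 ^ k * ((2 * k).factorial / k ^ k *
        (2 * Real.exp (25 * k))))) := by
  set r := Fintype.card V
  set N := Fintype.card (Sym2 V)
  have hk' : (0 : ℝ) < k := by exact_mod_cast hk
  set t := √(k : ℝ) with ht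
  have ht0 : 0 < t := Real.sqrt_pos.2 hk'
  have ht2 : t ^ 2 = k := Real.sq_sqrt hk'.le
  have hexp : ∀ z ∈ latticeNet V, ∀ t' : ℝ, t' ^ 2 = k →
      ∑ θ : Sym2 V → Fin 3, Real.exp (t' * (rescale z ⬝ᵥ skewMatrix θ *ᵥ rescale z)) ≤
        3 ^ N * Real.exp (25 * k) := by
    intro z hz t' ht'
    refine (sum_exp_skewMatrix_le _ _).trans (mul_le_mul_of_nonneg_left ?_ (by positivity))
    have h1 := rescale_dotProduct_self_le hz
    have h0 : 0 ≤ rescale z ⬝ᵥ rescale z := by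
      simp only [dotProduct]; exact Finset.sum_nonneg fun _ _ => mul_self_nonneg _
    have h2 : (rescale z ⬝ᵥ rescale z) ^ 2 ≤ (7 / 4) ^ 2 := pow_le_pow_left₀ h0 h1 2
    refine Real.exp_le_exp.2 ?_
    rw [ht']
    nlinarith
  have hmain : ∑ θ : Sym2 V → Fin 3, (skewMatrix θ ^ (2 * k)).trace ≤
      r * (384 ^ r * (9 ^ k * ((2 * k).factorial / k ^ k * (2 * Real.exp (25 * k))))) * 3 ^ N := by
    calc ∑ θ : Sym2 V → Fin 3, (skewMatrix θ ^ (2 * k)).trace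
        ≤ ∑ θ : Sym2 V → Fin 3, r * ∑ z ∈ latticeNet V,
            9 ^ k * (rescale z ⬝ᵥ skewMatrix θ *ᵥ rescale z) ^ (2 * k) := by
          refine Finset.sum_le_sum fun θ _ => ?_
          rw [trace_pow_eq_sum_eigenvalues_pow (skewMatrix_isHermitian θ)]
          obtain ⟨z, hz, hzl⟩ := exists_mem_latticeNet_eigenvalues_le (skewMatrix_isHermitian θ)
          rw [← nsmul_eq_mul, show r = (Finset.univ : Finset V).card from rfl, ← Finset.sum_const]
          refine Finset.sum_le_sum fun i _ => ?_
          have h1 : (skewMatrix_isHermitian θ).eigenvalues i ^ (2 * k) ≤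
              9 ^ k * (rescale z ⬝ᵥ skewMatrix θ *ᵥ rescale z) ^ (2 * k) := by
            rw [← (even_two_mul k).pow_abs]
            refine (pow_le_pow_left₀ (abs_nonneg _) (hzl i) _).trans_eq ?_
            rw [mul_pow, (even_two_mul k).pow_abs, pow_mul 3]
            norm_num
          refine h1.trans (Finset.single_le_sum (f := fun z => (9 : ℝ) ^ k *
            (rescale z ⬝ᵥ skewMatrix θ *ᵥ rescale z) ^ (2 * k)) (fun z _ => ?_) hz)
          exact mul_nonneg (by positivity) ((even_two_mul k).pow_nonneg _)
      _ = r * ∑ z ∈ latticeNet V, 9 ^ k * ∑ θ : Sym2 V → Fin 3,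
            (rescale z ⬝ᵥ skewMatrix θ *ᵥ rescale z) ^ (2 * k) := by
          rw [← Finset.mul_sum, Finset.sum_comm]
          simp only [Finset.mul_sum]
      _ ≤ r * ∑ _z ∈ latticeNet V, 9 ^ k * ((2 * k).factorial / k ^ k *
            (2 * (3 ^ N * Real.exp (25 * k)))) := by
          refine mul_le_mul_of_nonneg_left (Finset.sum_le_sum fun z hz => ?_) (by positivity)
          refine mul_le_mul_of_nonneg_left ?_ (by positivity)
          refine (Finset.sum_le_sum fun θ _ => pow_two_mul_le_factorial_mul ht0 k _).trans ?_
          rw [← Finset.mul_sum, pow_mul t, ht2, Finset.sum_add_distrib, two_mul (3 ^ N * _)]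
          refine mul_le_mul_of_nonneg_left (add_le_add ?_ ?_) (by positivity)
          · exact hexp z hz t ht2
          · exact hexp z hz (-t) (by rw [neg_sq, ht2])
      _ ≤ _ := by
          rw [Finset.sum_const, nsmul_eq_mul]
          have := mul_le_mul_of_nonneg_right (card_latticeNet_le V)
            (show 0 ≤ (r : ℝ) * (9 ^ k * ((2 * k).factorial / k ^ k *
            (2 * (3 ^ N * Real.exp (25 * k))))) by positivity)
          calc _ = _ := by ring
            _ ≤ _ := this
            _ = _ := by ring
  exact le_of_mul_le_mul_right ((card_doubleWalk_mul_le_sum_trace (2 * k)).trans hmain)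
    (by positivity)

end Comparison

/-! ### Moments of the centred adjacency matrix -/

section Adjacency

variable {Ω : Type*} [MeasurableSpace Ω] {μ : Measure Ω} [IsProbabilityMeasure μ] {n r : ℕ}
  {φ : Fin n → Fin r} {B : Matrix (Fin r) (Fin r) ℝ} {A : Ω → Matrix (Fin n) (Fin n) ℝ}

/-- The mean of the adjacency matrix. -/
def meanMatrix (φ : Fin n → Fin r) (B : Matrix (Fin r) (Fin r) ℝ) : Matrix (Fin n) (Fin n) ℝ :=
  Matrix.of fun i j => if i = j then 0 else B (φ i) (φ j)

/-- The ordered representative of the unordered pair of distinct nodes `i`, `j`. -/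
def edgeOf {i j : Fin n} (h : i ≠ j) : {e : Fin n × Fin n // e.1 < e.2} :=
  ⟨(min i j, max i j), min_lt_max.2 h⟩

lemma mk_edgeOf {i j : Fin n} (h : i ≠ j) : s((edgeOf h).1.1, (edgeOf h).1.2) = s(i, j) := by
  rcases le_total i j with h' | h' <;> simp [edgeOf, h', Sym2.eq_swap]

lemma edgeOf_eq_edgeOf {i j u v : Fin n} {h : i ≠ j} {h' : u ≠ v} (he : s(i, j) = s(u, v)) :
    edgeOf h = edgeOf h' := by
  rcases Sym2.eq_iff.1 he with ⟨rfl, rfl⟩ | ⟨rfl, rfl⟩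
  · rfl
  · simp only [edgeOf, min_comm, max_comm]

lemma apply_edgeOf {M : Matrix (Fin n) (Fin n) ℝ} (hM : M.IsSymm) {i j : Fin n} (h : i ≠ j) :
    M (edgeOf h).1.1 (edgeOf h).1.2 = M i j := by
  rcases le_total i j with h' | h'
  · simp [edgeOf, h']
  · simp only [edgeOf, min_eq_right h', max_eq_left h']; exact hM.apply i j

lemma meanMatrix_isSymm (hB : B.IsSymm) : (meanMatrix φ B).IsSymm := by
  ext i j
  simp [meanMatrix, eq_comm (a := i), hB.apply]

namespace IsAdjacency

lemma integrable_comp (hA : IsAdjacency μ φ B A) (i j : Fin n) {f : ℝ → ℝ} (hf : Measurable f) :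
    Integrable (fun ω => f (A ω i j)) μ := by
  refine Integrable.of_bound (hf.comp (hA.measurable_entry i j)).aestronglyMeasurable
    (max |f 0| |f 1|) (Filter.Eventually.of_forall fun ω => ?_)
  rcases hA.zero_or_one ω i j with h | h <;> simp [h]

lemma integral_comp (hA : IsAdjacency μ φ B A) (hB : B.IsSymm) {i j : Fin n} (hij : i ≠ j)
    {f : ℝ → ℝ} :
    ∫ ω, f (A ω i j) ∂μ = f 0 + B (φ i) (φ j) * (f 1 - f 0) := by
  have hprob : μ.real {ω | A ω i j = 1} = B (φ i) (φ j) := by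
    rcases lt_or_gt_of_ne hij with h | h
    · exact hA.prob_edge i j h
    · simp_rw [← (hA.isSymm _).apply i j, hA.prob_edge j i h, hB.apply]
  have hm : MeasurableSet {ω | A ω i j = 1} :=
    hA.measurable_entry i j (measurableSet_singleton 1)
  have h1 : (fun ω => f (A ω i j)) =
      fun ω => f 0 + {ω | A ω i j = 1}.indicator (fun _ => f 1 - f 0) ω := by
    ext ω
    rcases hA.zero_or_one ω i j with h | h <;> simp [Set.indicator, h]
  rw [h1, integral_add (integrable_const _) ((integrable_const _).indicator hm),
    integral_indicator_const _ hm, hprob]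
  simp

lemma prob_mem_Icc (hA : IsAdjacency μ φ B A) (hB : B.IsSymm) {i j : Fin n} (hij : i ≠ j) :
    B (φ i) (φ j) ∈ Set.Icc (0 : ℝ) 1 := by
  have h := hA.integral_comp hB hij (f := id)
  simp only [id, zero_add, sub_zero, mul_one] at h
  rw [← h]
  refine ⟨integral_nonneg fun ω => ?_, ?_⟩
  · rcases hA.zero_or_one ω i j with h | h <;> simp [h]
  · refine (integral_mono (hA.integrable_comp i j measurable_id) (integrable_const 1)
      fun ω => ?_).trans (by simp)
    rcases hA.zero_or_one ω i j with h | h <;> simp [h]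

/-- Since |A - b| ≤ 1, higher powers are dominated by the square, whose mean is b(1-b) ≤ b. -/
lemma abs_integral_centered_pow_le (hA : IsAdjacency μ φ B A) (hB : B.IsSymm) {i j : Fin n}
    (hij : i ≠ j) {m : ℕ} (hm : 2 ≤ m) :
    |∫ ω, (A ω i j - B (φ i) (φ j)) ^ m ∂μ| ≤ B (φ i) (φ j) := by
  obtain ⟨h0, h1⟩ := hA.prob_mem_Icc hB hij
  rw [hA.integral_comp hB hij (f := fun x => (x - B (φ i) (φ j)) ^ m)]
  set b := B (φ i) (φ j)
  have e1 : |(0 - b) ^ m| ≤ b ^ 2 := by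
    rw [abs_pow, zero_sub, abs_neg, abs_of_nonneg h0]
    exact pow_le_pow_of_le_one h0 h1 hm
  have e2 : |(1 - b) ^ m| ≤ (1 - b) ^ 2 := by
    rw [abs_pow, abs_of_nonneg (by linarith)]
    exact pow_le_pow_of_le_one (by linarith) (by linarith) hm
  calc |(0 - b) ^ m + b * ((1 - b) ^ m - (0 - b) ^ m)|
      = |(1 - b) * (0 - b) ^ m + b * (1 - b) ^ m| := by congr 1; ring
    _ ≤ |(1 - b) * (0 - b) ^ m| + |b * (1 - b) ^ m| := abs_add_le _ _
    _ = (1 - b) * |(0 - b) ^ m| + b * |(1 - b) ^ m| := by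
        rw [abs_mul, abs_mul, abs_of_nonneg (by linarith : 0 ≤ 1 - b), abs_of_nonneg h0]
    _ ≤ (1 - b) * b ^ 2 + b * (1 - b) ^ 2 :=
        add_le_add (mul_le_mul_of_nonneg_left e1 (by linarith)) (mul_le_mul_of_nonneg_left e2 h0)
    _ ≤ b := by nlinarith

lemma integral_centered_eq_zero (hA : IsAdjacency μ φ B A) (hB : B.IsSymm) {i j : Fin n}
    (hij : i ≠ j) : ∫ ω, (A ω i j - B (φ i) (φ j)) ∂μ = 0 := by
  rw [hA.integral_comp hB hij (f := fun x => x - B (φ i) (φ j))]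
  ring

/-- Independence factors the expectation over distinct edges. An edge used once gives a factor 0; in
a double walk each edge gives at most p, and there are at least (number of vertices) - 1 edges,
which suffices as p ≤ 1. -/
lemma abs_integral_walk_le (hA : IsAdjacency μ φ B A) (hB : B.IsSymm) {p : ℝ} (hp0 : 0 ≤ p)
    (hp1 : p ≤ 1) (hBp : ∀ k l, B k l ≤ p) {L : ℕ} (w : Fin (L + 1) → Fin n)
    (hw : w 0 = w (Fin.last L)) [Decidable (IsDoubleWalk w)] :
    |∫ ω, ∏ i : Fin L, (A ω - meanMatrix φ B) (w i.castSucc) (w i.succ) ∂μ| ≤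
      if IsDoubleWalk w then p ^ ((Finset.univ.image w).card - 1) else 0 := by
  have hsymm : ∀ ω, (A ω - meanMatrix φ B).IsSymm := fun ω =>
    (hA.isSymm ω).sub (meanMatrix_isSymm hB)
  by_cases hd : ∃ i : Fin L, w i.castSucc = w i.succ
  · obtain ⟨i, hi⟩ := hd
    have h0 : ∀ ω, ∏ i : Fin L, (A ω - meanMatrix φ B) (w i.castSucc) (w i.succ) = 0 := fun ω =>
      Finset.prod_eq_zero (Finset.mem_univ i) (by simp [hi, hA.diag_eq_zero, meanMatrix])
    simp only [h0, integral_zero, abs_zero]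
    split_ifs <;> positivity
  push Not at hd
  set g : Fin L → {e : Fin n × Fin n // e.1 < e.2} := fun i => edgeOf (hd i) with hg
  have hgs : ∀ i, stepEdge w i = s((g i).1.1, (g i).1.2) := fun i => (mk_edgeOf (hd i)).symm
  have hgg : ∀ i j, stepEdge w i = stepEdge w j → g i = g j := fun i j h => edgeOf_eq_edgeOf h
  set m : {e : Fin n × Fin n // e.1 < e.2} → ℕ :=
    fun e => (Finset.univ.filter fun i => g i = e).card with hm
  have hint : ∫ ω, ∏ i : Fin L, (A ω - meanMatrix φ B) (w i.castSucc) (w i.succ) ∂μ =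
      ∏ e, ∫ ω, (A ω e.1.1 e.1.2 - B (φ e.1.1) (φ e.1.2)) ^ m e ∂μ := by
    rw [← hA.indep.integral_fun_prod_comp
      (f := fun e x => (x - B (φ e.1.1) (φ e.1.2)) ^ m e)
      (fun e => (hA.measurable_entry _ _).aemeasurable)
      (fun e => (by fun_prop : Measurable fun x : ℝ =>
        (x - B (φ e.1.1) (φ e.1.2)) ^ m e).aestronglyMeasurable)]
    congr 1
    ext ω
    rw [← prod_comp_eq_prod_pow g fun e => A ω e.1.1 e.1.2 - B (φ e.1.1) (φ e.1.2)]
    refine Finset.prod_congr rfl fun i _ => ?_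
    rw [← apply_edgeOf (hsymm ω) (hd i)]
    simp [meanMatrix, hg, (edgeOf (hd i)).2.ne]
  rw [hint, Finset.abs_prod]
  split_ifs with hdw
  · have hfac : ∀ e, |∫ ω, (A ω e.1.1 e.1.2 - B (φ e.1.1) (φ e.1.2)) ^ m e ∂μ| ≤
        if e ∈ Finset.univ.image g then p else 1 := by
      intro e
      split_ifs with he
      · obtain ⟨i, -, rfl⟩ := Finset.mem_image.1 he
        obtain ⟨j, hj, hji⟩ := hdw.2 i
        refine (hA.abs_integral_centered_pow_le hB (g i).2.ne ?_).trans (hBp _ _)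
        exact Finset.one_lt_card.2 ⟨j, by simp [hgg _ _ hji], i, by simp, hj⟩
      · have : m e = 0 := by
          rw [hm, Finset.card_eq_zero, Finset.filter_eq_empty_iff]
          exact fun i _ hi => he (by simp [← hi])
        simp [this]
    refine (Finset.prod_le_prod (fun _ _ => abs_nonneg _) fun e _ => hfac e).trans ?_
    rw [Finset.prod_ite_mem, Finset.univ_inter, Finset.prod_const]
    refine pow_le_pow_of_le_one hp0 hp1 ?_
    have h1 := card_image_le_card_stepEdge_add_one w
    have h2 : Finset.univ.image (stepEdge w) =
        (Finset.univ.image g).image fun e => s(e.1.1, e.1.2) := by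
      rw [Finset.image_image]
      exact Finset.image_congr fun i _ => hgs i
    have h3 := Finset.card_image_le (s := Finset.univ.image g)
      (f := fun e : {e : Fin n × Fin n // e.1 < e.2} => s(e.1.1, e.1.2))
    rw [← h2] at h3
    omega
  · have : ∃ i, ∀ j, j ≠ i → stepEdge w j ≠ stepEdge w i := by
      by_contra hcon
      push Not at hcon
      exact hdw ⟨hw, hcon⟩
    obtain ⟨i, hi⟩ := this
    have hmi : m (g i) = 1 := by
      rw [hm, Finset.card_eq_one]
      refine ⟨i, ?_⟩
      ext j
      simp only [Finset.mem_filter, Finset.mem_univ, true_and, Finset.mem_singleton]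
      refine ⟨fun h => ?_, fun h => by rw [h]⟩
      by_contra hne
      exact hi j hne (by rw [hgs, hgs, h])
    refine (Finset.prod_eq_zero (Finset.mem_univ (g i)) ?_).le
    rw [hmi]
    simp only [pow_one]
    rw [hA.integral_centered_eq_zero hB (g i).2.ne, abs_zero]

lemma abs_sub_mean_le_one (hA : IsAdjacency μ φ B A) (hB : B.IsSymm) (ω : Ω) (i j : Fin n) :
    |(A ω - meanMatrix φ B) i j| ≤ 1 := by
  by_cases hij : i = j
  · simp [hij, hA.diag_eq_zero, meanMatrix]
  · obtain ⟨h0, h1⟩ := hA.prob_mem_Icc hB hij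
    rw [abs_le]
    simp only [Matrix.sub_apply, meanMatrix, Matrix.of_apply, hij, if_false]
    rcases hA.zero_or_one ω i j with h | h <;> rw [h] <;> constructor <;> linarith

lemma integrable_walk (hA : IsAdjacency μ φ B A) (hB : B.IsSymm) {L : ℕ}
    (w : Fin (L + 1) → Fin n) : Integrable (fun ω =>
      ∏ i : Fin L, (A ω - meanMatrix φ B) (w i.castSucc) (w i.succ)) μ := by
  refine Integrable.of_bound (C := 1) ?_ (Filter.Eventually.of_forall fun ω => ?_)
  · refine (Finset.measurable_fun_prod _ fun i _ => ?_).aestronglyMeasurable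
    exact (hA.measurable_entry _ _).sub_const _
  · rw [Real.norm_eq_abs, Finset.abs_prod]
    exact Finset.prod_le_one (fun _ _ => abs_nonneg _) fun i _ => hA.abs_sub_mean_le_one hB _ _ _

lemma integrable_trace_pow (hA : IsAdjacency μ φ B A) (hB : B.IsSymm) (L : ℕ) :
    Integrable (fun ω => ((A ω - meanMatrix φ B) ^ L).trace) μ := by
  simp only [trace_pow_eq_sum_walk]
  refine integrable_finsetSum _ fun w _ => ?_
  split_ifs
  · exact hA.integrable_walk hB w
  · exact integrable_zero _ _ _

open Classical in
lemma integral_trace_pow_le (hA : IsAdjacency μ φ B A) (hB : B.IsSymm) {p : ℝ} (hp0 : 0 ≤ p)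
    (hp1 : p ≤ 1) (hBp : ∀ k l, B k l ≤ p) {k s : ℕ} (hks : k + 1 ≤ s) (hnp : n * p ≤ s - k) :
    ∫ ω, ((A ω - meanMatrix φ B) ^ (2 * k)).trace ∂μ ≤
      n * ((Finset.univ.filter fun u : Fin (2 * k + 1) → Fin s => IsDoubleWalk u).card : ℝ) := by
  have h := sum_doubleWalk_le (V := Fin n) (W := Fin s) (k := k) hp0 (by simpa using hks)
    (by simpa using hnp)
  rw [Fintype.card_fin] at h
  refine le_trans ?_ h
  simp only [trace_pow_eq_sum_walk]
  rw [integral_finsetSum, Finset.sum_filter]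
  · refine Finset.sum_le_sum fun w _ => ?_
    by_cases hw : w 0 = w (Fin.last (2 * k))
    · simp only [hw, if_true]
      convert! (le_abs_self _).trans (hA.abs_integral_walk_le hB hp0 hp1 hBp w hw)
    · simp only [hw, if_false, integral_zero]
      split_ifs <;> positivity
  · intro w _
    split_ifs
    · exact hA.integrable_walk hB w
    · exact integrable_zero _ _ _

/-- Exponential moments of weighted degrees. -/
lemma integral_exp_degree_le (hA : IsAdjacency μ φ B A) (hB : B.IsSymm) (i : Fin n)
    (s : Fin n → ℝ) :
    ∫ ω, Real.exp (∑ j, s j * A ω i j) ∂μ ≤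
      Real.exp (∑ j with j ≠ i, B (φ i) (φ j) * (Real.exp (s j) - 1)) := by
  -- Edges at a fixed node are distinct unordered pairs, so the off-diagonal entries of a row are
  -- independent.
  have hinj : Function.Injective fun j : {j // j ≠ i} => edgeOf j.2.symm := by
    intro j j' h
    have := congrArg (fun e : {e : Fin n × Fin n // e.1 < e.2} => s(e.1.1, e.1.2)) h
    simp only [mk_edgeOf, Sym2.eq_iff] at this
    rcases this with ⟨_, h⟩ | ⟨h, _⟩
    · exact Subtype.ext h
    · exact absurd h.symm j'.2
  have hind := hA.indep.precomp hinj
  have h1 : ∫ ω, Real.exp (∑ j, s j * A ω i j) ∂μ =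
      ∏ j : {j // j ≠ i}, ∫ ω, Real.exp (s j * A ω i j) ∂μ := by
    have h := hind.integral_fun_prod_comp (f := fun (j : {j // j ≠ i}) x => Real.exp (s j * x))
      (fun e => (hA.measurable_entry _ _).aemeasurable)
      (fun e => (by fun_prop : Measurable fun x : ℝ => Real.exp (s e * x)).aestronglyMeasurable)
    simp only [apply_edgeOf (hA.isSymm _)] at h
    rw [← h]
    congr 1
    ext ω
    rw [← Real.exp_sum, ← Finset.sum_subtype (Finset.univ.filter fun j => j ≠ i) (by simp)
      fun j => s j * A ω i j, Finset.sum_filter]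
    congr 1
    refine Finset.sum_congr rfl fun j _ => ?_
    split_ifs with hj
    · rfl
    · rw [not_not.1 hj, hA.diag_eq_zero, mul_zero]
  rw [h1, Finset.sum_subtype (Finset.univ.filter fun j => j ≠ i) (p := fun j => j ≠ i) (by simp)
      fun j => B (φ i) (φ j) * (Real.exp (s j) - 1), Real.exp_sum]
  refine Finset.prod_le_prod (fun _ _ => integral_nonneg fun _ => (Real.exp_pos _).le)
    fun j _ => ?_
  rw [hA.integral_comp hB j.2.symm (f := fun x => Real.exp (s j * x))]
  simp only [mul_zero, mul_one, Real.exp_zero]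
  have := Real.add_one_le_exp (B (φ i) (φ j) * (Real.exp (s j) - 1))
  linarith

end IsAdjacency

end Adjacency

/-! ### The dual certificate -/

section Certificate

variable {n : ℕ} {φ : Fin n → Fin 2}

/-- The `±1` labels of a partition into two clusters. -/
def sgn (φ : Fin n → Fin 2) (i : Fin n) : ℝ := if φ i = 0 then 1 else -1

lemma sgn_mul_self (i : Fin n) : sgn φ i * sgn φ i = 1 := by
  unfold sgn; split_ifs <;> norm_num

lemma sgn_mul_sgn (i j : Fin n) : sgn φ i * sgn φ j = if φ i = φ j then 1 else -1 := by
  unfold sgn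
  generalize φ i = k
  generalize φ j = l
  fin_cases k <;> fin_cases l <;> simp

lemma partitionMatrix_apply_eq (i j : Fin n) :
    partitionMatrix φ i j = 1 / 2 + sgn φ i * sgn φ j / 2 := by
  rw [sgn_mul_sgn, partitionMatrix, Matrix.of_apply]
  split_ifs <;> norm_num

lemma EqualSized.card_eq (hφ : EqualSized φ) (k : Fin 2) :
    ((Finset.univ.filter fun i => φ i = k).card : ℝ) = n / 2 := by
  have : ((2 * (Finset.univ.filter fun i => φ i = k).card : ℕ) : ℝ) = n := by
    exact_mod_cast hφ k
  push_cast at this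
  linarith

lemma EqualSized.sum_partitionMatrix (hφ : EqualSized φ) (i : Fin n) :
    ∑ j, partitionMatrix φ i j = n / 2 := by
  simp only [partitionMatrix, Matrix.of_apply, Finset.sum_ite, Finset.sum_const_zero, add_zero,
    Finset.sum_const, nsmul_eq_mul, mul_one]
  rw [← hφ.card_eq (φ i)]
  simp only [eq_comm]

lemma EqualSized.sum_sgn (hφ : EqualSized φ) : ∑ i, sgn φ i = 0 := by
  rcases Nat.eq_zero_or_pos n with rfl | hn
  · simp
  have h := hφ.sum_partitionMatrix ⟨0, hn⟩
  simp only [partitionMatrix_apply_eq, Finset.sum_add_distrib, ← Finset.sum_div,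
    ← Finset.mul_sum, Finset.sum_const, Finset.card_univ, Fintype.card_fin, nsmul_eq_mul] at h
  have h1 : sgn φ ⟨0, hn⟩ * ∑ i, sgn φ i = 0 := by linarith
  rw [← one_mul (∑ i, sgn φ i), ← sgn_mul_self (φ := φ) ⟨0, hn⟩, mul_assoc, h1, mul_zero]

lemma EqualSized.isFeasible_partitionMatrix (hφ : EqualSized φ) :
    IsFeasible 2 (partitionMatrix φ) where
  posSemidef := by
    have : partitionMatrix φ = (Matrix.of fun (k : Fin 2) i => if φ i = k then (1 : ℝ) else 0)ᴴ *
        Matrix.of fun (k : Fin 2) i => if φ i = k then (1 : ℝ) else 0 := by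
      ext i j
      simp [partitionMatrix, Matrix.mul_apply, eq_comm]
    rw [this]
    exact Matrix.posSemidef_conjTranspose_mul_self _
  nonneg i j := by
    simp only [partitionMatrix, Matrix.of_apply]
    split_ifs <;> norm_num
  row_sum := by
    ext i
    simp only [Matrix.mulVec, dotProduct, mul_one]
    exact hφ.sum_partitionMatrix i
  diag_eq_one i := by simp [partitionMatrix]

/-- The number of neighbours in the own cluster minus the number of neighbours in the other. -/
def degreeGap (φ : Fin n → Fin 2) (A : Matrix (Fin n) (Fin n) ℝ) (i : Fin n) : ℝ :=
  ∑ j, sgn φ i * sgn φ j * A i j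

/-- The dual slack matrix. -/
def slack (φ : Fin n → Fin 2) (A : Matrix (Fin n) (Fin n) ℝ) : Matrix (Fin n) (Fin n) ℝ :=
  Matrix.diagonal (degreeGap φ A) - A

variable {A : Matrix (Fin n) (Fin n) ℝ}

/-- Complementary slackness: the degree gaps are exactly the diagonal that puts the labels in the
kernel. -/
lemma slack_mulVec_sgn : slack φ A *ᵥ sgn φ = 0 := by
  ext i
  rw [slack, Matrix.sub_mulVec, Pi.sub_apply, Matrix.mulVec_diagonal, degreeGap, Finset.sum_mul]
  simp only [Matrix.mulVec, dotProduct, Pi.zero_apply, sub_eq_zero]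
  refine Finset.sum_congr rfl fun j _ => ?_
  linear_combination (sgn φ j * A i j) * sgn_mul_self (φ := φ) i

lemma slack_isSymm (hA : A.IsSymm) : (slack φ A).IsSymm :=
  (Matrix.isSymm_diagonal _).sub hA

/-- Positivity of the slack matrix on the complement of the constants and the labels. -/
def SlackPos (φ : Fin n → Fin 2) (A : Matrix (Fin n) (Fin n) ℝ) : Prop :=
  ∀ x : Fin n → ℝ, ∑ i, x i = 0 → ∑ i, sgn φ i * x i = 0 → x ≠ 0 → 0 < x ⬝ᵥ slack φ A *ᵥ x

/-- The component of `y` along the labels lies in the kernel, so it can be projected away before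
applying strict positivity. -/
lemma SlackPos.nonneg_and_eq (h : SlackPos φ A) (hA : A.IsSymm) (hφ : EqualSized φ)
    {y : Fin n → ℝ} (hy : ∑ i, y i = 0) :
    0 ≤ y ⬝ᵥ slack φ A *ᵥ y ∧
      (y ⬝ᵥ slack φ A *ᵥ y = 0 → ∃ c : ℝ, y = c • sgn φ) := by
  rcases Nat.eq_zero_or_pos n with rfl | hn
  · exact ⟨by simp [dotProduct], fun _ => ⟨0, by ext i; exact i.elim0⟩⟩
  have hn' : (0 : ℝ) < n := by exact_mod_cast hn
  set c := (∑ i, sgn φ i * y i) / n with hc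
  set x := y - c • sgn φ with hx
  have hyx : y ⬝ᵥ slack φ A *ᵥ y = x ⬝ᵥ slack φ A *ᵥ x := by
    have h1 : slack φ A *ᵥ x = slack φ A *ᵥ y := by
      rw [hx, Matrix.mulVec_sub, Matrix.mulVec_smul, slack_mulVec_sgn, smul_zero, sub_zero]
    have h2 : sgn φ ⬝ᵥ slack φ A *ᵥ y = 0 := by
      rw [Matrix.dotProduct_mulVec, ← Matrix.mulVec_transpose, slack_isSymm hA, slack_mulVec_sgn,
        zero_dotProduct]
    rw [h1, hx, sub_dotProduct, smul_dotProduct, h2, smul_zero, sub_zero]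
  have hx1 : ∑ i, x i = 0 := by
    simp [hx, Finset.sum_sub_distrib, ← Finset.mul_sum, hy, hφ.sum_sgn]
  have hx2 : ∑ i, sgn φ i * x i = 0 := by
    have : ∑ i, sgn φ i * x i = ∑ i, sgn φ i * y i - c * n := by
      simp only [hx, Pi.sub_apply, Pi.smul_apply, smul_eq_mul, mul_sub, Finset.sum_sub_distrib,
        mul_left_comm _ c, sgn_mul_self, ← Finset.mul_sum]
      simp
    rw [this, hc, div_mul_cancel₀ _ hn'.ne', sub_self]
  rw [hyx]
  by_cases hx0 : x = 0
  · refine ⟨by simp [hx0], fun _ => ⟨c, sub_eq_zero.1 hx0⟩⟩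
  · have := h x hx1 hx2 hx0
    exact ⟨this.le, fun h0 => absurd h0 this.ne'⟩

/-- The duality gap of a matrix. -/
noncomputable def gap (φ : Fin n → Fin 2) (A Y : Matrix (Fin n) (Fin n) ℝ) : ℝ :=
  ∑ i, ∑ j, (Y i j - 1 / 2) * slack φ A i j

lemma traceInner_eq (A Y : Matrix (Fin n) (Fin n) ℝ) :
    traceInner Y A = ∑ i, ∑ j, Y i j * A i j := by
  simp only [traceInner, Matrix.trace, Matrix.diag_apply, Matrix.mul_apply,
    Matrix.transpose_apply]
  rw [Finset.sum_comm]

/-- The right side does not involve `Y`, thanks to the unit diagonal, so maximising the objective is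
minimising the gap. -/
lemma IsFeasible.traceInner_add_gap {Y : Matrix (Fin n) (Fin n) ℝ} (hY : IsFeasible 2 Y) :
    traceInner Y A + gap φ A Y =
      ∑ i, degreeGap φ A i - ∑ i, ∑ j, 1 / 2 * slack φ A i j := by
  rw [traceInner_eq, gap, ← Finset.sum_add_distrib, ← Finset.sum_sub_distrib]
  refine Finset.sum_congr rfl fun i _ => ?_
  have h1 : degreeGap φ A i = ∑ j, Y i j * Matrix.diagonal (degreeGap φ A) i j := by
    simp [Matrix.diagonal_apply, hY.diag_eq_one]
  rw [h1, ← Finset.sum_add_distrib, ← Finset.sum_sub_distrib]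
  refine Finset.sum_congr rfl fun j _ => ?_
  rw [slack, Matrix.sub_apply]
  ring

lemma gap_partitionMatrix : gap φ A (partitionMatrix φ) = 0 := by
  have h : ∀ i, ∑ j, slack φ A i j * sgn φ j = 0 := fun i => congrFun slack_mulVec_sgn i
  refine Finset.sum_eq_zero fun i _ => ?_
  rw [show (0 : ℝ) = sgn φ i / 2 * ∑ j, slack φ A i j * sgn φ j by rw [h, mul_zero],
    Finset.mul_sum]
  refine Finset.sum_congr rfl fun j _ => ?_
  rw [partitionMatrix_apply_eq]
  ring

open scoped MatrixOrder in
lemma exists_eq_conjTranspose_mul_self {Y : Matrix (Fin n) (Fin n) ℝ} (hY : Y.PosSemidef) :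
    ∃ b : Matrix (Fin n) (Fin n) ℝ, Y = bᴴ * b :=
  CStarAlgebra.nonneg_iff_eq_star_mul_self.1 hY.nonneg

/-- Here `m` is the mean of the Gram vectors. The row sums force every Gram vector to have inner
product 1/2 with `m`, and `m` itself to have squared norm 1/2, so centring subtracts exactly 1/2
from every entry. -/
lemma IsFeasible.exists_gram {Y : Matrix (Fin n) (Fin n) ℝ} (hY : IsFeasible 2 Y) (hn : 0 < n) :
    ∃ (b : Fin n → Fin n → ℝ) (m : Fin n → ℝ), (∀ i j, Y i j = ∑ k, b k i * b k j) ∧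
      (∀ k, ∑ i, (b k i - m k) = 0) ∧
      ∀ i j, Y i j - 1 / 2 = ∑ k, (b k i - m k) * (b k j - m k) := by
  have hn' : (0 : ℝ) < n := by exact_mod_cast hn
  obtain ⟨b, hb⟩ := exists_eq_conjTranspose_mul_self hY.posSemidef
  have hYb : ∀ i j, Y i j = ∑ k, b k i * b k j := by
    intro i j
    rw [hb]
    simp [Matrix.mul_apply]
  have hrow : ∀ i, ∑ j, Y i j = n / 2 := by
    intro i
    have := congrFun hY.row_sum i
    simpa [Matrix.mulVec, dotProduct] using this
  set m : Fin n → ℝ := fun k => (∑ l, b k l) / n with hm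
  have hmb : ∀ j, ∑ k, b k j * m k = 1 / 2 := by
    intro j
    have h1 : ∑ k, b k j * m k = (∑ l, Y j l) / n := by
      simp only [hYb, hm, mul_div_assoc', ← Finset.sum_div, Finset.mul_sum]
      rw [Finset.sum_comm]
    rw [h1, hrow]
    field_simp
  have hmm : ∑ k, m k * m k = 1 / 2 := by
    have h1 : ∑ k, m k * m k = (∑ j, ∑ k, b k j * m k) / n := by
      rw [Finset.sum_comm, Finset.sum_div]
      refine Finset.sum_congr rfl fun k _ => ?_
      rw [← Finset.sum_mul, mul_div_right_comm]
    rw [h1]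
    simp only [hmb, Finset.sum_const, Finset.card_univ, Fintype.card_fin, nsmul_eq_mul]
    field_simp
  refine ⟨b, m, hYb, fun k => ?_, fun i j => ?_⟩
  · rw [Finset.sum_sub_distrib]
    simp only [Finset.sum_const, Finset.card_univ, Fintype.card_fin, nsmul_eq_mul, hm]
    field_simp
    ring
  · have : ∀ k, (b k i - m k) * (b k j - m k) =
        b k i * b k j - b k i * m k - b k j * m k + m k * m k := fun k => by ring
    simp only [this, Finset.sum_add_distrib, Finset.sum_sub_distrib, hmb, hmm, ← hYb]
    ring

/-- Strict positivity of the slack matrix certifies the planted partition as the unique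
optimum. -/
lemma SlackPos.isUniqueOptimal (h : SlackPos φ A) (hA : A.IsSymm) (hφ : EqualSized φ)
    (hn : 0 < n) : IsUniqueOptimal 2 A (partitionMatrix φ) := by
  have hgap : ∀ Y, IsFeasible 2 Y → 0 ≤ gap φ A Y ∧ (gap φ A Y = 0 → Y = partitionMatrix φ) := by
    intro Y hY
    obtain ⟨b, m, hYb, hsum, hYm⟩ := hY.exists_gram hn
    have hg : gap φ A Y =
        ∑ k, (fun i => b k i - m k) ⬝ᵥ slack φ A *ᵥ fun i => b k i - m k := by
      simp only [gap, hYm, dotProduct, Matrix.mulVec, Finset.sum_mul, Finset.mul_sum]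
      simp_rw [Finset.sum_comm (γ := Fin n) (s := Finset.univ) (t := Finset.univ)
        (f := fun j k => (b k _ - m k) * (b k j - m k) * slack φ A _ j)]
      rw [Finset.sum_comm]
      refine Finset.sum_congr rfl fun k _ => Finset.sum_congr rfl fun i _ =>
        Finset.sum_congr rfl fun j _ => by ring
    have hq := fun k => h.nonneg_and_eq hA hφ (hsum k)
    refine ⟨hg ▸ Finset.sum_nonneg fun k _ => (hq k).1, fun h0 => ?_⟩
    rw [hg, Finset.sum_eq_zero_iff_of_nonneg fun k _ => (hq k).1] at h0
    -- At zero gap each centred coordinate is a multiple of the labels, so nodes of one cluster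
    -- share a Gram vector and `Y` is 1 there. Nonnegativity and the row sums then leave only 0
    -- across clusters.
    have hb : ∀ k i j, φ i = φ j → b k i = b k j := by
      intro k i j hij
      obtain ⟨c, hc⟩ := (hq k).2 (h0 k (Finset.mem_univ k))
      have hi := congrFun hc i
      have hj := congrFun hc j
      simp only [Pi.smul_apply, sgn, hij] at hi hj
      linarith
    have hsame : ∀ i j, φ i = φ j → Y i j = 1 := by
      intro i j hij
      rw [← hY.diag_eq_one i, hYb, hYb]
      exact Finset.sum_congr rfl fun k _ => by rw [hb k i j hij]
    have hle : ∀ i j, partitionMatrix φ i j ≤ Y i j := by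
      intro i j
      simp only [partitionMatrix, Matrix.of_apply]
      split_ifs with hij
      · exact (hsame i j hij).ge
      · exact hY.nonneg i j
    ext i j
    have hrow : ∑ j, Y i j = ∑ j, partitionMatrix φ i j := by
      rw [hφ.sum_partitionMatrix]
      simpa [Matrix.mulVec, dotProduct] using congrFun hY.row_sum i
    exact ((Finset.sum_eq_sum_iff_of_le fun j _ => hle i j).1 hrow.symm j (Finset.mem_univ j)).symm
  have hfeas := hφ.isFeasible_partitionMatrix
  have hX := hfeas.traceInner_add_gap (φ := φ) (A := A)
  rw [gap_partitionMatrix] at hX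
  refine ⟨⟨hfeas, fun Y hY => ?_⟩, fun Y hY => ?_⟩
  · have h1 := hY.traceInner_add_gap (φ := φ) (A := A)
    linarith [(hgap Y hY).1]
  · refine (hgap Y hY.1).2 (le_antisymm ?_ (hgap Y hY.1).1)
    have h1 := hY.1.traceInner_add_gap (φ := φ) (A := A)
    linarith [hY.2 _ hfeas]

lemma pqMatrix_isSymm (r : ℕ) (p q : ℝ) : (pqMatrix r p q).IsSymm := by
  ext k l
  simp [pqMatrix, eq_comm (a := k)]

/-- The mean is a combination of the all-ones matrix and s sᵀ, minus p on the diagonal; only the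
diagonal correction survives on this subspace. -/
lemma dotProduct_meanMatrix_mulVec {p q : ℝ} {x : Fin n → ℝ} (h1 : ∑ i, x i = 0)
    (h2 : ∑ i, sgn φ i * x i = 0) :
    x ⬝ᵥ meanMatrix φ (pqMatrix 2 p q) *ᵥ x = -p * (x ⬝ᵥ x) := by
  have hm : ∀ i j, meanMatrix φ (pqMatrix 2 p q) i j * x j = (p + q) / 2 * x j +
      (p - q) / 2 * sgn φ i * (sgn φ j * x j) - if i = j then p * x j else 0 := by
    intro i j
    rw [← mul_assoc, mul_assoc _ (sgn φ i), sgn_mul_sgn]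
    simp only [meanMatrix, pqMatrix, Matrix.of_apply]
    by_cases hij : i = j
    · subst hij; simp; ring
    · by_cases hφ : φ i = φ j <;> simp [hij, hφ] <;> ring
  have hv : ∀ i, (meanMatrix φ (pqMatrix 2 p q) *ᵥ x) i = -p * x i := by
    intro i
    simp only [Matrix.mulVec, dotProduct, hm]
    rw [Finset.sum_sub_distrib, Finset.sum_add_distrib, ← Finset.mul_sum, ← Finset.mul_sum, h1, h2]
    simp
  simp only [dotProduct, hv, Finset.mul_sum]
  exact Finset.sum_congr rfl fun i _ => by ring

/-- An even trace power dominates that power of each eigenvalue, so the noise form is at most c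
|x|². The degree gaps strictly beat this, and the mean only helps, by p |x|². -/
lemma slackPos_of_trace_pow_lt (hA : A.IsSymm) {p q c : ℝ} (hp : 0 ≤ p) (hc : 0 ≤ c) {k : ℕ}
    (hdeg : ∀ i, c < degreeGap φ A i)
    (htr : ((A - meanMatrix φ (pqMatrix 2 p q)) ^ (2 * k)).trace < c ^ (2 * k)) :
    SlackPos φ A := by
  intro x h1 h2 hx
  set X := A - meanMatrix φ (pqMatrix 2 p q) with hX
  have hXs : X.IsHermitian := by
    rw [Matrix.IsHermitian, Matrix.conjTranspose_eq_transpose_of_trivial]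
    exact hA.sub (meanMatrix_isSymm (pqMatrix_isSymm _ _ _))
  have heig : ∀ i, |hXs.eigenvalues i| ≤ c := by
    intro i
    rw [trace_pow_eq_sum_eigenvalues_pow hXs] at htr
    have h3 : hXs.eigenvalues i ^ (2 * k) ≤ ∑ i, hXs.eigenvalues i ^ (2 * k) :=
      Finset.single_le_sum (f := fun i => hXs.eigenvalues i ^ (2 * k))
        (fun _ _ => (even_two_mul k).pow_nonneg _) (Finset.mem_univ i)
    rw [← (even_two_mul k).pow_abs] at h3
    exact (lt_of_pow_lt_pow_left₀ _ hc (h3.trans_lt htr)).le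
  have h3 := (abs_le.1 (abs_dotProduct_mulVec_le hXs heig x)).2
  have h4 : x ⬝ᵥ A *ᵥ x = x ⬝ᵥ X *ᵥ x + -p * (x ⬝ᵥ x) := by
    rw [← dotProduct_meanMatrix_mulVec (φ := φ) (q := q) h1 h2, ← dotProduct_add,
      ← Matrix.add_mulVec, hX, sub_add_cancel]
  have hxx : 0 < x ⬝ᵥ x := by
    obtain ⟨i, hi⟩ := Function.ne_iff.1 hx
    exact Finset.sum_pos' (fun _ _ => mul_self_nonneg _)
      ⟨i, Finset.mem_univ i, mul_self_pos.2 hi⟩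
  have h5 : c * (x ⬝ᵥ x) < x ⬝ᵥ Matrix.diagonal (degreeGap φ A) *ᵥ x := by
    obtain ⟨i, hi⟩ := Function.ne_iff.1 hx
    simp only [dotProduct, Matrix.mulVec_diagonal, Finset.mul_sum]
    refine Finset.sum_lt_sum (fun j _ => ?_) ⟨i, Finset.mem_univ i, ?_⟩
    · nlinarith [hdeg j, mul_self_nonneg (x j)]
    · nlinarith [hdeg i, mul_self_pos.2 hi]
  rw [slack, Matrix.sub_mulVec, dotProduct_sub, h4]
  nlinarith

end Certificate

/-! ### Probability estimates -/

section Recovery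

variable {Ω : Type*} [MeasurableSpace Ω] {μ : Measure Ω} [IsProbabilityMeasure μ] {n : ℕ}
  {φ : Fin n → Fin 2} {A : Ω → Matrix (Fin n) (Fin n) ℝ}

/-- The node itself is missing from its own cluster, hence n/2 - 1. -/
lemma EqualSized.sum_pqMatrix_mul (hφ : EqualSized φ) (i : Fin n) (p q t : ℝ) :
    ∑ j with j ≠ i, pqMatrix 2 p q (φ i) (φ j) * (Real.exp (-t * (sgn φ i * sgn φ j)) - 1) =
      (n / 2 - 1) * (p * (Real.exp (-t) - 1)) + n / 2 * (q * (Real.exp t - 1)) := by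
  have h : ∀ j, pqMatrix 2 p q (φ i) (φ j) * (Real.exp (-t * (sgn φ i * sgn φ j)) - 1) =
      if φ j = φ i then p * (Real.exp (-t) - 1) else q * (Real.exp t - 1) := by
    intro j
    rw [sgn_mul_sgn]
    by_cases hij : φ i = φ j
    · simp [pqMatrix, hij]
    · simp [pqMatrix, hij, Ne.symm hij]
  have hcompl : ((Finset.univ.filter fun j => ¬φ j = φ i).card : ℝ) = n / 2 := by
    have h1 := Finset.card_filter_add_card_filter_not (s := Finset.univ) fun j => φ j = φ i
    have h2 := hφ.card_eq (φ i)
    have h3 : ((Finset.univ.filter fun j => φ j = φ i).card : ℝ) +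
        (Finset.univ.filter fun j => ¬φ j = φ i).card = n := by
      rw [← Nat.cast_add, h1, Finset.card_univ, Fintype.card_fin]
    linarith
  have h4 := Finset.sum_erase_eq_sub (s := Finset.univ) (a := i) (f := fun j =>
    if φ j = φ i then p * (Real.exp (-t) - 1) else q * (Real.exp t - 1)) (Finset.mem_univ i)
  simp only [h, Finset.filter_ne']
  rw [h4, Finset.sum_ite, Finset.sum_const, Finset.sum_const, nsmul_eq_mul, nsmul_eq_mul,
    hφ.card_eq, hcompl]
  simp
  ring

/-- Chernoff bound for the degree gap. -/
lemma IsAdjacency.prob_degreeGap_le {p q : ℝ} (hA : IsAdjacency μ φ (pqMatrix 2 p q) A)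
    (hφ : EqualSized φ) {t : ℝ} (ht : 0 ≤ t) (i : Fin n) (δ : ℝ) :
    μ.real {ω | degreeGap φ (A ω) i ≤ δ} ≤ Real.exp (t * δ +
      ((n / 2 - 1) * (p * (Real.exp (-t) - 1)) + n / 2 * (q * (Real.exp t - 1)))) := by
  have hrw : ∀ ω, -t * degreeGap φ (A ω) i = ∑ j, -t * (sgn φ i * sgn φ j) * A ω i j := by
    intro ω
    simp only [degreeGap, Finset.mul_sum, mul_assoc]
  have hint : Integrable (fun ω => Real.exp (-t * degreeGap φ (A ω) i)) μ := by
    simp only [hrw]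
    refine Integrable.of_bound (C := Real.exp (∑ j, |-t * (sgn φ i * sgn φ j)|)) ?_
      (Filter.Eventually.of_forall fun ω => ?_)
    · refine (Real.measurable_exp.comp (Finset.measurable_fun_sum _ fun j _ => ?_)).aestronglyMeasurable
      exact (hA.measurable_entry i j).const_mul _
    · rw [Real.norm_eq_abs, Real.abs_exp]
      refine Real.exp_le_exp.2 (Finset.sum_le_sum fun j _ => ?_)
      rcases hA.zero_or_one ω i j with h | h <;> rw [h]
      · rw [mul_zero]; exact abs_nonneg _
      · rw [mul_one]; exact le_abs_self _
  refine (measure_le_le_exp_mul_mgf δ (neg_nonpos.2 ht) hint).trans ?_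
  rw [neg_neg, Real.exp_add, ← hφ.sum_pqMatrix_mul i p q t]
  refine mul_le_mul_of_nonneg_left ?_ (Real.exp_pos _).le
  rw [mgf]
  simp only [hrw]
  exact hA.integral_exp_degree_le (pqMatrix_isSymm _ _ _) i fun j => -t * (sgn φ i * sgn φ j)

lemma IsAdjacency.prob_exists_degreeGap_le {p q : ℝ}
    (hA : IsAdjacency μ φ (pqMatrix 2 p q) A) (hφ : EqualSized φ) {t : ℝ} (ht : 0 ≤ t) (δ : ℝ) :
    μ.real {ω | ∃ i, degreeGap φ (A ω) i ≤ δ} ≤ n * Real.exp (t * δ +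
      ((n / 2 - 1) * (p * (Real.exp (-t) - 1)) + n / 2 * (q * (Real.exp t - 1)))) := by
  rw [Set.ofPred_exists]
  refine (measureReal_iUnion_fintype_le _).trans
    ((Finset.sum_le_sum fun i _ => hA.prob_degreeGap_le hφ ht i δ).trans_eq ?_)
  rw [Finset.sum_const, Finset.card_univ, Fintype.card_fin, nsmul_eq_mul]

/-- The exponential rate in the Chernoff bound at the optimal tilt. -/
lemma chernoff_exponent_le {a b d m p : ℝ} (hb : 0 < b) (hab : b < a) (hm : 0 < m)
    (hp : p = a * d / m) (hd : 0 ≤ d) (hp1 : p ≤ 1) :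
    (m / 2 - 1) * (p * (Real.exp (-(Real.log (√a / √b))) - 1)) +
      m / 2 * (b * d / m * (Real.exp (Real.log (√a / √b)) - 1)) ≤
      1 - d * ((√a - √b) ^ 2 / 2) := by
  have ha : 0 < a := hb.trans hab
  have hsa : 0 < √a := Real.sqrt_pos.2 ha
  have hsb : 0 < √b := Real.sqrt_pos.2 hb
  have ha2 : √a ^ 2 = a := Real.sq_sqrt ha.le
  have hb2 : √b ^ 2 = b := Real.sq_sqrt hb.le
  rw [Real.exp_neg, Real.exp_log (by positivity), inv_div]
  have hp0 : 0 ≤ p := by rw [hp]; positivity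
  -- This tilt minimises a e^(-t) + b e^t, with value 2√(ab). The missing own-cluster neighbour
  -- costs p(1 - √b/√a) ≤ 1.
  have h1 : (m / 2 - 1) * (p * (√b / √a - 1)) + m / 2 * (b * d / m * (√a / √b - 1)) =
      p * (1 - √b / √a) - d * ((√a - √b) ^ 2 / 2) := by
    have e1 : m * p = √a ^ 2 * d := by rw [hp, ha2]; field_simp
    have e2 : m / 2 * (b * d / m * (√a / √b - 1)) = √b ^ 2 * d / 2 * (√a / √b - 1) := by
      rw [hb2]; field_simp
    have e3 : √a ^ 2 * d / 2 * (√b / √a - 1) + √b ^ 2 * d / 2 * (√a / √b - 1) =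
        - (d * ((√a - √b) ^ 2 / 2)) := by
      field_simp
      ring
    rw [e2, ← neg_eq_iff_eq_neg.2 e3.symm.symm]
    linear_combination (1 / 2 * (√b / √a - 1)) * e1
  rw [h1]
  have h2 : 0 ≤ √b / √a := by positivity
  nlinarith

/-- On R k vertices everything is exponential in k except (2k)!/k^k ≤ 4^k k^k. The prefactor 2Rk is
absorbed in 4^(Rk), so 1536 = 4 · 384 and 36 = 9 · 4. -/
lemma walkBound_le {R k : ℕ} (hR : 0 < R) (hk : 0 < k) :
    ((R * k : ℕ) : ℝ) * (384 ^ (R * k) * (9 ^ k * ((2 * k).factorial / k ^ k *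
        (2 * Real.exp (25 * k))))) ≤ (1536 ^ R * 36 * Real.exp 25 * k) ^ k := by
  have hk' : (0 : ℝ) < k := by exact_mod_cast hk
  have h1 : ((R * k : ℕ) : ℝ) * 2 ≤ 4 ^ (R * k) := by
    have h2 : R * k < 2 ^ (R * k) := Nat.lt_two_pow_self
    have h3 : 2 ≤ 2 ^ (R * k) := by
      calc 2 = 2 ^ 1 := rfl
        _ ≤ 2 ^ (R * k) := Nat.pow_le_pow_right (by norm_num) (Nat.mul_pos hR hk)
    have h4 : 4 ^ (R * k) = 2 ^ (R * k) * 2 ^ (R * k) := by rw [← mul_pow]; norm_num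
    have : R * k * 2 ≤ 4 ^ (R * k) := h4 ▸ Nat.mul_le_mul h2.le h3
    exact_mod_cast this
  have h2 : ((2 * k).factorial : ℝ) / k ^ k ≤ 4 ^ k * k ^ k := by
    rw [div_le_iff₀ (by positivity)]
    have : ((2 * k).factorial : ℝ) ≤ (2 * k : ℝ) ^ (2 * k) := by
      exact_mod_cast Nat.factorial_le_pow (2 * k)
    refine this.trans_eq ?_
    rw [pow_mul, mul_pow, mul_pow, sq (k : ℝ), mul_pow]
    norm_num [mul_assoc]
  have h3 : Real.exp (25 * k) = Real.exp 25 ^ k := by rw [← Real.exp_nat_mul, mul_comm]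
  calc ((R * k : ℕ) : ℝ) * (384 ^ (R * k) * (9 ^ k * ((2 * k).factorial / k ^ k *
        (2 * Real.exp (25 * k)))))
      = (((R * k : ℕ) : ℝ) * 2) * (384 ^ (R * k) * 9 ^ k * Real.exp (25 * k)) *
          ((2 * k).factorial / k ^ k) := by ring
    _ ≤ 4 ^ (R * k) * (384 ^ (R * k) * 9 ^ k * Real.exp (25 * k)) * (4 ^ k * k ^ k) := by
        gcongr
    _ = (4 * 384) ^ (R * k) * (9 * 4 * Real.exp 25 * k) ^ k := by
        rw [h3]; simp only [mul_pow]; ring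
    _ = _ := by
        rw [pow_mul, ← mul_pow]; norm_num [mul_assoc]

/-- Markov's inequality, with R k comparison vertices: R ≥ a + 1 gives np = a d ≤ R k - k. -/
lemma IsAdjacency.prob_trace_pow_ge_le {a b : ℝ} (hb : 0 < b) (hab : b < a) (hn : 0 < n)
    {d : ℝ} (hd : 0 ≤ d) (hA : IsAdjacency μ φ (pqMatrix 2 (a * d / n) (b * d / n)) A)
    (hp1 : a * d / n ≤ 1) {R k : ℕ} (hR : a + 1 ≤ R) (hk : 0 < k) (hdk : d ≤ k) {θ : ℝ}
    (hθ : 0 < θ) :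
    μ.real {ω | θ ≤ ((A ω - meanMatrix φ (pqMatrix 2 (a * d / n) (b * d / n))) ^ (2 * k)).trace} ≤
      n * (1536 ^ R * 36 * Real.exp 25 * k) ^ k / θ := by
  have hB := pqMatrix_isSymm 2 (a * d / n) (b * d / n)
  have hn' : (0 : ℝ) < n := by exact_mod_cast hn
  have hk' : (0 : ℝ) < k := by exact_mod_cast hk
  have ha : 0 < a := hb.trans hab
  have hR1 : 1 < R := by
    have : (1 : ℝ) < R := by linarith
    exact_mod_cast this
  rw [le_div_iff₀ hθ, mul_comm]
  refine (mul_meas_ge_le_integral_of_nonneg (Filter.Eventually.of_forall fun ω => ?_)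
    (hA.integrable_trace_pow hB _) θ).trans ?_
  · have hX : (A ω - meanMatrix φ (pqMatrix 2 (a * d / n) (b * d / n))).IsHermitian := by
      rw [Matrix.IsHermitian, Matrix.conjTranspose_eq_transpose_of_trivial]
      exact (hA.isSymm ω).sub (meanMatrix_isSymm hB)
    simp only [Pi.zero_apply]
    rw [trace_pow_eq_sum_eigenvalues_pow hX]
    exact Finset.sum_nonneg fun _ _ => (even_two_mul k).pow_nonneg _
  · classical
    have : Nonempty (Fin (R * k)) := ⟨⟨0, Nat.mul_pos (by omega) hk⟩⟩
    have h1 := card_doubleWalk_le (V := Fin (R * k)) hk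
    rw [Fintype.card_fin] at h1
    have hks : k + 1 ≤ R * k := by nlinarith
    refine (hA.integral_trace_pow_le hB (p := a * d / n) (by positivity) hp1 ?_ hks ?_).trans ?_
    · intro i j
      simp only [pqMatrix, Matrix.of_apply]
      split_ifs
      · exact le_rfl
      · gcongr
    · rw [mul_div_cancel₀ _ hn'.ne']
      push_cast
      nlinarith
    · refine mul_le_mul_of_nonneg_left ?_ hn'.le
      refine le_trans ?_ (h1.trans (walkBound_le (by omega) hk))
      refine le_of_eq ?_
      congr!

/-- The base C k/(ε d)² is O(1/d), so it is below e^(-3) once d is large; then k ≥ d is used. The 3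
leaves room for the factor n = e^d. -/
lemma moment_ratio_le {C ε d : ℝ} {k : ℕ} (hC : 0 < C) (hε : 0 < ε) (hd : 1 ≤ d) (hdk : d ≤ k)
    (hkd : k ≤ 2 * d) (hlarge : 2 * C * Real.exp 3 / ε ^ 2 ≤ d) :
    (C * k) ^ k / (ε * d) ^ (2 * k) ≤ Real.exp (-(3 * d)) := by
  rw [pow_mul, ← div_pow]
  have h1 : C * k / (ε * d) ^ 2 ≤ Real.exp (-3) := by
    rw [div_le_iff₀ (by positivity)] at hlarge
    rw [div_le_iff₀ (by positivity), Real.exp_neg, ← div_eq_inv_mul, le_div_iff₀ (Real.exp_pos 3)]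
    calc C * k * Real.exp 3 ≤ C * (2 * d) * Real.exp 3 := by gcongr
      _ = 2 * C * Real.exp 3 * d := by ring
      _ ≤ d * ε ^ 2 * d := by gcongr
      _ = (ε * d) ^ 2 := by ring
  calc (C * k / (ε * d) ^ 2) ^ k ≤ Real.exp (-3) ^ k := pow_le_pow_left₀ (by positivity) h1 k
    _ = Real.exp (-(3 * k)) := by rw [← Real.exp_nat_mul]; congr 1; ring
    _ ≤ _ := Real.exp_le_exp.2 (by linarith)

end Recovery

end SBM

theorem mainTheorem2 (a b : ℝ) (hb : 0 < b) (hab : √2 < √a - √b) :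
    ∃ c : ℝ, 0 < c ∧ ∃ N : ℕ, ∀ n : ℕ, N ≤ n →
      ∀ φ : Fin n → Fin 2, SBM.EqualSized φ →
      ∀ (Ω : Type*) [MeasurableSpace Ω] (μ : Measure Ω) [IsProbabilityMeasure μ]
        (A : Ω → Matrix (Fin n) (Fin n) ℝ),
        SBM.IsAdjacency μ φ
          (SBM.pqMatrix 2 (a * Real.log n / n) (b * Real.log n / n)) A →
        1 - (n : ℝ) ^ (-c) ≤
          μ.real {ω | SBM.IsUniqueOptimal 2 (A ω) (SBM.partitionMatrix φ)} := by
  have hs2 : 0 < √(2 : ℝ) := by positivity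
  have hsb : 0 < √b := Real.sqrt_pos.2 hb
  have hsba : √b < √a := by linarith
  have hba : b < a := (Real.sqrt_lt_sqrt_iff hb.le).1 hsba
  have ha : 0 < a := hb.trans hba
  set t := Real.log (√a / √b) with ht
  have ht0 : 0 < t := Real.log_pos ((one_lt_div hsb).2 hsba)
  -- The surplus of the Chernoff exponent over the union bound.
  set κ := (√a - √b) ^ 2 / 2 - 1 with hκ
  have hκ0 : 0 < κ := by
    have : √2 ^ 2 < (√a - √b) ^ 2 := pow_lt_pow_left₀ hab hs2.le two_ne_zero
    rw [Real.sq_sqrt (by norm_num)] at this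
    linarith
  -- Raising the degree threshold from 0 to ε log n costs t ε = κ/2, half of the surplus.
  set ε := κ / (2 * t) with hε
  have hε0 : 0 < ε := by positivity
  have htε : t * ε = κ / 2 := by rw [hε]; field_simp
  set R : ℕ := ⌈a⌉₊ + 1 with hR
  have hRa : a + 1 ≤ R := by
    rw [hR]; push_cast; linarith [Nat.le_ceil a]
  set C : ℝ := 1536 ^ R * 36 * Real.exp 25 with hC
  have hC0 : 0 < C := by positivity
  set c := min (κ / 4) 1 with hc
  have hlog : Filter.Tendsto (fun n : ℕ => Real.log n) Filter.atTop Filter.atTop :=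
    Real.tendsto_log_atTop.comp tendsto_natCast_atTop_atTop
  have hev : ∀ᶠ n : ℕ in Filter.atTop, 0 < n ∧ a * Real.log n / n ≤ 1 ∧
      1 ≤ Real.log n ∧ 8 / κ ≤ Real.log n ∧ 2 * C * Real.exp 3 / ε ^ 2 ≤ Real.log n := by
    have h1 : ∀ᶠ n : ℕ in Filter.atTop, ‖Real.log n‖ ≤ a⁻¹ * ‖(n : ℝ)‖ :=
      tendsto_natCast_atTop_atTop.eventually
        (Real.isLittleO_log_id_atTop.def (inv_pos.2 ha))
    filter_upwards [Filter.eventually_gt_atTop 0, h1, hlog.eventually_ge_atTop 1,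
      hlog.eventually_ge_atTop (8 / κ),
      hlog.eventually_ge_atTop (2 * C * Real.exp 3 / ε ^ 2)] with n h0 h1 h2 h3 h4
    refine ⟨h0, ?_, h2, h3, h4⟩
    have h0' : (0 : ℝ) < n := by exact_mod_cast h0
    rw [Real.norm_of_nonneg (by linarith), Real.norm_of_nonneg h0'.le, ← div_eq_inv_mul,
      le_div_iff₀ ha] at h1
    rw [div_le_one h0']
    linarith
  obtain ⟨N, hN⟩ := Filter.eventually_atTop.1 hev
  refine ⟨c, lt_min (by positivity) one_pos, N, ?_⟩
  intro n hn φ hφ Ω _ μ _ A hA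
  obtain ⟨hn0, hp1, hd1, hdκ, hdC⟩ := hN n hn
  have hn' : (0 : ℝ) < n := by exact_mod_cast hn0
  set d := Real.log n with hd
  have hnd : (n : ℝ) = Real.exp d := (Real.exp_log hn').symm
  set k := ⌈d⌉₊ with hk
  have hdk : d ≤ k := Nat.le_ceil d
  have hkd : (k : ℝ) ≤ 2 * d := by
    linarith [Nat.ceil_lt_add_one (show 0 ≤ d by linarith)]
  have hk0 : 0 < k := Nat.ceil_pos.2 (by linarith)
  set bad₁ := {ω | ∃ i, SBM.degreeGap φ (A ω) i ≤ ε * d} with hbad₁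
  set bad₂ := {ω | (ε * d) ^ (2 * k) ≤ ((A ω - SBM.meanMatrix φ
    (SBM.pqMatrix 2 (a * d / n) (b * d / n))) ^ (2 * k)).trace} with hbad₂
  have hb₁ : μ.real bad₁ ≤ Real.exp (1 - κ / 2 * d) := by
    refine (hA.prob_exists_degreeGap_le hφ ht0.le (ε * d)).trans ?_
    have h1 := SBM.chernoff_exponent_le hb hba hn' rfl (by linarith) hp1
    rw [← ht] at h1
    have h2 : (√a - √b) ^ 2 / 2 = κ + 1 := by rw [hκ]; ring
    rw [h2] at h1
    refine (mul_le_mul_of_nonneg_left (Real.exp_le_exp.2 (add_le_add_right h1 _)) hn'.le).trans_eq ?_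
    conv_lhs => rw [hnd, ← Real.exp_add, ← mul_assoc, htε]
    congr 1
    ring
  have hb₂ : μ.real bad₂ ≤ Real.exp (-(2 * d)) := by
    refine (hA.prob_trace_pow_ge_le hb hba hn0 (by linarith) hp1 hRa hk0 hdk
      (by positivity)).trans ?_
    rw [mul_div_assoc]
    refine (mul_le_mul_of_nonneg_left
      (SBM.moment_ratio_le hC0 hε0 hd1 hdk hkd hdC) hn'.le).trans_eq ?_
    rw [hnd, ← Real.exp_add]
    congr 1
    ring
  have hcover : Set.univ ⊆ {ω | SBM.IsUniqueOptimal 2 (A ω) (SBM.partitionMatrix φ)} ∪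
      (bad₁ ∪ bad₂) := by
    intro ω _
    by_cases h1 : ω ∈ bad₁
    · exact Or.inr (Or.inl h1)
    by_cases h2 : ω ∈ bad₂
    · exact Or.inr (Or.inr h2)
    simp only [hbad₁, hbad₂, Set.mem_ofPred_eq, not_exists, not_le] at h1 h2
    exact Or.inl ((SBM.slackPos_of_trace_pow_lt (hA.isSymm ω) (by positivity) (by positivity)
      h1 h2).isUniqueOptimal (hA.isSymm ω) hφ hn0)
  have htotal : 1 ≤ μ.real {ω | SBM.IsUniqueOptimal 2 (A ω) (SBM.partitionMatrix φ)} +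
      (μ.real bad₁ + μ.real bad₂) := by
    calc (1 : ℝ) = μ.real Set.univ := probReal_univ.symm
      _ ≤ _ := measureReal_mono hcover
      _ ≤ _ := measureReal_union_le _ _
      _ ≤ _ := add_le_add_right (measureReal_union_le _ _) _
  -- Each failure bound is at most n^(-c)/e, using κ d ≥ 8 for the degrees and d ≥ 1 for the trace;
  -- then 2 ≤ e.
  have hfin : Real.exp (1 - κ / 2 * d) + Real.exp (-(2 * d)) ≤ (n : ℝ) ^ (-c) := by
    have hκd : 8 ≤ d * κ := (div_le_iff₀ hκ0).1 hdκ
    have hc1 : c ≤ κ / 4 := min_le_left _ _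
    have hc2 : c ≤ 1 := min_le_right _ _
    have h1 : Real.exp (1 - κ / 2 * d) ≤ Real.exp (d * -c - 1) :=
      Real.exp_le_exp.2 (by nlinarith)
    have h2 : Real.exp (-(2 * d)) ≤ Real.exp (d * -c - 1) :=
      Real.exp_le_exp.2 (by nlinarith)
    have h3 : Real.exp (d * -c) = Real.exp (d * -c - 1) * Real.exp 1 := by
      rw [← Real.exp_add]; congr 1; ring
    rw [Real.rpow_def_of_pos hn', ← hd, h3]
    nlinarith [Real.add_one_le_exp 1, Real.exp_pos (d * -c - 1)]
  linarith
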